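/- Let $\mathcal H$ be a separable complex Hilbert space and let $G$ be a positive self-adjoint (possibly unbounded) operator on $\mathcal H$ with dense domain $\mathcal D(G)$ such that $\inf\{\|G\varphi\| : \varphi\in\mathcal D(G),\ \|\varphi\|=1\}=0$. For $\varphi\in\mathcal H$ put $\langle\varphi|G|\varphi\rangle=\|\sqrt G\varphi\|^2$ if $\varphi\in\mathcal D(\sqrt G)$ and $\langle\varphi|G|\varphi\rangle=+\infty$ otherwise. For a positive trace-class operator $\rho$ put $\operatorname{Tr}G\rho=\sup_n\operatorname{Tr}P_nG\rho\in[0,+\infty]$, where $P_n$ is the spectral projector of $G$ corresponding to $[0,n]$ (and $P_nG$ is extended by continuity to $\mathcal H$). A state is a positive trace-class operator with trace $1$. For a bounded operator $A$ on $\mathcal H$ and $E>0$ let $$\|A\|^G_E=\sup_{\|\varphi\|=1,\ \langle\varphi|G|\varphi\rangle\le E}\|A\varphi\|.\qquad(1)$$ This equals $$\sup_{\rho\ \text{a state},\ \operatorname{Tr}G\rho\le E}\sqrt{\operatorname{Tr}A\rho A^*}.\qquad(2)$$ Then for every bounded operator $A$ on $\mathcal H$ and every $E>0$ the following hold. (A)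 The suprema in (1) and (2) can be taken over the unit ball and over the subnormalized positive operators, respectively: $$\|A\|^G_E=\sup_{\|\varphi\|\le1,\ \langle\varphi|G|\varphi\rangle\le E}\|A\varphi\|=\sup_{\rho\ge0,\ \operatorname{Tr}\rho\le1,\ \operatorname{Tr}G\rho\le E}\sqrt{\operatorname{Tr}A\rho A^*}.$$ (B) If $G$ is unbounded, then the conditions $\langle\varphi|G|\varphi\rangle\le E$ in (1) and $\operatorname{Tr}G\rho\le E$ in (2) can be replaced by $\langle\varphi|G|\varphi\rangle=E$ and $\operatorname{Tr}G\rho=E$, respectively, without changing the values of the suprema. (C) Suppose that $G$ is an unbounded discrete operator, i.e. there are an orthonormal basis $(\tau_k)_{k\ge0}$ of $\mathcal H$ and a nondecreasing sequence $(E_k)_{k\ge0}$ of reals tending to $+\infty$ such that $\mathcal D(G)=\{\varphi : \sum_kE_k^2|\langle\tau_k|\varphi\rangle|^2<+\infty\}$ and $G\varphi=\sum_kE_k\langle\tau_k|\varphi\rangle\tau_k$ for $\varphi\in\mathcal D(G)$. Then the suprema in (1) and (2) are attained. If, moreover, $\|A\|^G_E<\|A\|$, then they are attained, respectively, at a unit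 vector $\varphi_0$ with $\langle\varphi_0|G|\varphi_0\rangle=E$ and at a state $\rho_0$ with $\operatorname{Tr}G\rho_0=E$. -/

import Mathlib

open scoped InnerProductSpace ENNReal

namespace OperatorENorm

variable {H : Type*} [NormedAddCommGroup H] [InnerProductSpace ℂ H]

theorem injective_of_resolvent {G : H →ₗ.[ℂ] H} {R : H →L[ℂ] H}
    (hR : ∀ x y : H, (x, y) ∈ G.graph ↔ R (x + y) = x) {z : H} (h : R z = 0) : z = 0 := by
  have h1 : ((0 : H), z) ∈ G.graph := (hR 0 z).mpr (by rw [zero_add, h])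
  exact G.graph_fst_eq_zero_snd h1 rfl

variable [CompleteSpace H]

/-! ### Positive self-adjoint operators, their square roots and spectral projectors -/

/-- A (possibly unbounded) positive self-adjoint operator `G`. Self-adjointness includes that the
domain of `G` is dense, see `IsSelfAdjoint.dense_domain`. -/
structure IsPosSelfAdjoint (G : H →ₗ.[ℂ] H) : Prop where
  isSelfAdjoint : IsSelfAdjoint G
  nonneg : ∀ x : G.domain, 0 ≤ (⟪(x : H), G x⟫_ℂ).re

/-- `S` is a positive self-adjoint square root of `G`: `S ∘ S = G` as partially defined operators,
i.e. `x ∈ D(G)` and `G x = y` if and only if `x ∈ D(S)`, `S x ∈ D(S)` and `S (S x) = y`. -/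
def IsPosSqrt (G S : H →ₗ.[ℂ] H) : Prop :=
  IsPosSelfAdjoint S ∧
    ∀ x y : H, (x, y) ∈ G.graph ↔ ∃ z : H, (x, z) ∈ S.graph ∧ (z, y) ∈ S.graph

/-- `P` is the spectral projector of the positive self-adjoint operator `G` corresponding to the
interval `[0, n]`: the orthogonal projector that commutes with `G`, with range contained in the
domain of `G`, such that `G ≤ n` on the range of `P` and `G > n` on the orthogonal complement.
Exactly one `P` has these properties, see `existsUnique_spectralProj`. -/
structure IsSpectralProj (G : H →ₗ.[ℂ] H) (n : ℝ) (P : H →L[ℂ] H) : Prop where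
  isStarProjection : IsStarProjection P
  mem_domain : ∀ x : H, P x ∈ G.domain
  commutes : ∀ x y : H, (x, y) ∈ G.graph → (P x, P y) ∈ G.graph
  le_on_range : ∀ x : G.domain, P x = x → (⟪(x : H), G x⟫_ℂ).re ≤ n * ‖(x : H)‖ ^ 2
  lt_on_ker : ∀ x : G.domain, P x = 0 → (x : H) ≠ 0 →
    n * ‖(x : H)‖ ^ 2 < (⟪(x : H), G x⟫_ℂ).re

theorem symm_graph {G : H →ₗ.[ℂ] H} (hG : IsPosSelfAdjoint G) {a b c d : H}
    (h : (a, b) ∈ G.graph) (h' : (c, d) ∈ G.graph) : ⟪b, c⟫_ℂ = ⟪a, d⟫_ℂ := by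
  have hd := hG.isSelfAdjoint.dense_domain
  have e := LinearPMap.adjoint_graph_eq_graph_adjoint (T := G) hd
  rw [LinearPMap.isSelfAdjoint_def.mp hG.isSelfAdjoint] at e
  rw [e, Submodule.mem_adjoint_iff] at h'
  exact sub_eq_zero.mp (h' _ _ h)

theorem mem_graph_of_symm {G : H →ₗ.[ℂ] H} (hG : IsPosSelfAdjoint G) {c d : H}
    (h : ∀ a b : H, (a, b) ∈ G.graph → ⟪b, c⟫_ℂ = ⟪a, d⟫_ℂ) : (c, d) ∈ G.graph := by
  have hd := hG.isSelfAdjoint.dense_domain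
  have e := LinearPMap.adjoint_graph_eq_graph_adjoint (T := G) hd
  rw [LinearPMap.isSelfAdjoint_def.mp hG.isSelfAdjoint] at e
  rw [e, Submodule.mem_adjoint_iff]
  exact fun a b hab => sub_eq_zero.mpr (h a b hab)

theorem nonneg_graph {G : H →ₗ.[ℂ] H} (hG : IsPosSelfAdjoint G) {a b : H}
    (h : (a, b) ∈ G.graph) : 0 ≤ (⟪a, b⟫_ℂ).re := by
  obtain ⟨x, hx, hy⟩ := (LinearPMap.mem_graph_iff _).mp h
  simp only at hx hy
  rw [← hx, ← hy]
  exact hG.nonneg x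

theorem norm_le_of_graph {G : H →ₗ.[ℂ] H} (hG : IsPosSelfAdjoint G) {a b : H}
    (h : (a, b) ∈ G.graph) : ‖a‖ ≤ ‖a + b‖ := by
  have h1 := nonneg_graph hG h
  have h2 := norm_add_sq (𝕜 := ℂ) a b
  simp only [RCLike.re_to_complex] at h2
  exact (abs_le_of_sq_le_sq' (by nlinarith [sq_nonneg ‖b‖]) (norm_nonneg _)).2

/-- The operator `R = (1 + G)⁻¹`. -/
theorem exists_resolvent {G : H →ₗ.[ℂ] H} (hG : IsPosSelfAdjoint G) :
    ∃ R : H →L[ℂ] H, (∀ x y : H, (x, y) ∈ G.graph ↔ R (x + y) = x) ∧ 0 ≤ R ∧ R ≤ 1 := by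
  have hcl : IsClosed (G.graph : Set (H × H)) := hG.isSelfAdjoint.isClosed
  have : CompleteSpace G.graph := hcl.completeSpace_coe
  let f : G.graph →L[ℂ] H :=
    (ContinuousLinearMap.fst ℂ H H + ContinuousLinearMap.snd ℂ H H).comp G.graph.subtypeL
  have hf : ∀ p : G.graph, f p = (p : H × H).1 + (p : H × H).2 := fun p => rfl
  have hanti : AntilipschitzWith 2 f := by
    refine f.antilipschitz_of_bound fun p => ?_
    have h1 : ‖(p : H × H).1‖ ≤ ‖f p‖ := norm_le_of_graph hG p.2
    have h2 : ‖(p : H × H).2‖ ≤ ‖f p‖ + ‖(p : H × H).1‖ := by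
      have : (p : H × H).2 = f p - (p : H × H).1 := by rw [hf]; abel
      rw [this]; exact norm_sub_le _ _
    rw [Submodule.coe_norm, Prod.norm_def]
    push_cast
    exact max_le (by linarith [norm_nonneg (f p)]) (by linarith)
  have hrc : IsClosed (f.range : Set H) := by
    rw [LinearMap.coe_range]
    exact hanti.isClosed_range f.uniformContinuous
  have hperp : f.rangeᗮ = ⊥ := by
    rw [Submodule.eq_bot_iff]
    intro z hz
    have h1 : ∀ a b : H, (a, b) ∈ G.graph → ⟪b, z⟫_ℂ = ⟪a, -z⟫_ℂ := by
      intro a b hab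
      have := (Submodule.mem_orthogonal _ _).mp hz (f ⟨(a, b), hab⟩) ⟨_, rfl⟩
      rw [hf, inner_add_left] at this
      rw [inner_neg_right]
      linear_combination this
    have h2 := nonneg_graph hG (mem_graph_of_symm hG h1)
    rw [inner_neg_right, inner_self_eq_norm_sq_to_K] at h2
    have h3 : ‖z‖ ^ 2 ≤ 0 := by
      have : ((‖z‖ : ℂ) ^ 2).re = ‖z‖ ^ 2 := by norm_cast
      simp only [Complex.coe_algebraMap, Complex.neg_re] at h2
      linarith
    simpa using h3
  have hsurj : f.range = ⊤ := by
    have : CompleteSpace f.range := hrc.completeSpace_coe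
    exact Submodule.orthogonal_eq_bot_iff.mp hperp
  let e := ContinuousLinearEquiv.ofBijective f
    (LinearMap.ker_eq_bot.mpr hanti.injective) hsurj
  let R : H →L[ℂ] H :=
    ((ContinuousLinearMap.fst ℂ H H).comp G.graph.subtypeL).comp e.symm.toContinuousLinearMap
  have hiff : ∀ x y : H, (x, y) ∈ G.graph ↔ R (x + y) = x := by
    intro x y
    constructor
    · intro h
      have : e.symm (x + y) = ⟨(x, y), h⟩ := by
        rw [ContinuousLinearEquiv.symm_apply_eq]; rfl
      change ((e.symm (x + y) : G.graph) : H × H).1 = x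
      rw [this]
    · intro h
      change ((e.symm (x + y) : G.graph) : H × H).1 = x at h
      have h2 : f (e.symm (x + y)) = x + y := e.apply_symm_apply (x + y)
      rw [hf, h, add_right_inj] at h2
      have h3 := (e.symm (x + y)).2
      rwa [← Prod.mk.eta (p := ((e.symm (x + y) : G.graph) : H × H)), h, h2] at h3
  have hmem : ∀ z, (R z, z - R z) ∈ G.graph := fun z => (hiff _ _).mpr (by simp)
  have hsymm : ∀ z w, ⟪R z, w⟫_ℂ = ⟪z, R w⟫_ℂ := by
    intro z w
    have := symm_graph hG (hmem z) (hmem w)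
    rw [inner_sub_left, inner_sub_right] at this
    linear_combination -this
  have hre : ∀ z, ‖R z‖ ^ 2 ≤ (⟪R z, z⟫_ℂ).re := by
    intro z
    have h1 := nonneg_graph hG (hmem z)
    rw [inner_sub_right, inner_self_eq_norm_sq_to_K] at h1
    have : ((‖R z‖ : ℂ) ^ 2).re = ‖R z‖ ^ 2 := by norm_cast
    simp only [Complex.coe_algebraMap, Complex.sub_re] at h1
    linarith
  refine ⟨R, hiff, ?_, ?_⟩
  · rw [ContinuousLinearMap.nonneg_iff_isPositive, ContinuousLinearMap.isPositive_def]
    exact ⟨hsymm, fun z => (sq_nonneg _).trans (hre z)⟩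
  · rw [ContinuousLinearMap.le_def, ContinuousLinearMap.isPositive_def]
    refine ⟨fun z w => ?_, fun z => ?_⟩
    · have := hsymm z w
      simp [inner_sub_left, inner_sub_right, this]
    · have h1 := hre z
      have h2 : (⟪R z, z⟫_ℂ).re ≤ ‖R z‖ * ‖z‖ := re_inner_le_norm (𝕜 := ℂ) _ _
      have h3 : ((‖z‖ : ℂ) ^ 2).re = ‖z‖ ^ 2 := by norm_cast
      have h4 : (⟪R z, z⟫_ℂ).re ≤ ‖z‖ ^ 2 := by
        nlinarith [sq_nonneg (‖R z‖ - ‖z‖), norm_nonneg z, norm_nonneg (R z)]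
      simp [ContinuousLinearMap.reApplyInnerSelf, inner_sub_left, h3]
      simpa [inner_self_eq_norm_sq_to_K, h3] using h4


theorem exists_posSqrt {G : H →ₗ.[ℂ] H} (hG : IsPosSelfAdjoint G) : ∃ S, IsPosSqrt G S := by
  obtain ⟨R, hR, hR0, hR1⟩ := exists_resolvent hG
  have hR1' : 0 ≤ 1 - R := sub_nonneg.mpr hR1
  set Q := CFC.sqrt R with hQ
  set T := CFC.sqrt (1 - R) with hT
  have hQ0 : 0 ≤ Q := CFC.sqrt_nonneg _
  have hT0 : 0 ≤ T := CFC.sqrt_nonneg _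
  have hQQ : Q * Q = R := CFC.sqrt_mul_sqrt_self R
  have hTT : T * T = 1 - R := CFC.sqrt_mul_sqrt_self (1 - R)
  have hQT : Q * T = T * Q := by
    have h1 : Commute R T := by
      have : Commute (1 - R) R := (Commute.one_left R).sub_left (Commute.refl R)
      exact (this.cfcₙ_nnreal NNReal.sqrt).symm
    exact h1.cfcₙ_nnreal NNReal.sqrt
  have aQQ : ∀ z, Q (Q z) = R z := fun z => congrArg (fun B : H →L[ℂ] H => B z) hQQ
  have aTT : ∀ z, T (T z) = z - R z := fun z => congrArg (fun B : H →L[ℂ] H => B z) hTT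
  have aQT : ∀ z, Q (T z) = T (Q z) := fun z => congrArg (fun B : H →L[ℂ] H => B z) hQT
  have sQ : ∀ z w, ⟪Q z, w⟫_ℂ = ⟪z, Q w⟫_ℂ :=
    ((ContinuousLinearMap.nonneg_iff_isPositive Q).mp hQ0).inner_left_eq_inner_right
  have sT : ∀ z w, ⟪T z, w⟫_ℂ = ⟪z, T w⟫_ℂ :=
    ((ContinuousLinearMap.nonneg_iff_isPositive T).mp hT0).inner_left_eq_inner_right
  have pQT : ∀ z, 0 ≤ (⟪z, Q (T z)⟫_ℂ).re := by
    have : 0 ≤ Q * T := Commute.mul_nonneg hQ0 hT0 hQT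
    exact ((ContinuousLinearMap.nonneg_iff_isPositive _).mp this).re_inner_nonneg_right
  have iQ : ∀ z, Q z = 0 → z = 0 := fun z hz =>
    injective_of_resolvent hR (by rw [← aQQ, hz, map_zero])
  let g : Submodule ℂ (H × H) := (Q.prod T).range
  have hg : ∀ x ∈ g, x.1 = 0 → x.2 = 0 := by
    rintro _ ⟨z, rfl⟩ h
    have : z = 0 := iQ z h
    simp [this]
  have memS : ∀ x y : H, (x, y) ∈ g.toLinearPMap.graph ↔ ∃ z, Q z = x ∧ T z = y := by
    intro x y
    rw [Submodule.toLinearPMap_graph_eq g hg]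
    constructor
    · rintro ⟨z, hz⟩
      exact ⟨z, congrArg Prod.fst hz, congrArg Prod.snd hz⟩
    · rintro ⟨z, rfl, rfl⟩
      exact ⟨z, rfl⟩
  refine ⟨g.toLinearPMap, ⟨?_, ?_⟩, ?_⟩
  · have hd : Dense (g.toLinearPMap.domain : Set H) := by
      refine hG.isSelfAdjoint.dense_domain.mono fun x hx => ?_
      obtain ⟨y, hy⟩ := LinearPMap.mem_domain_iff.mp hx
      have h1 := (hR x y).mp hy
      exact LinearPMap.mem_domain_of_mem_graph
        ((memS x (T (Q (x + y)))).mpr ⟨Q (x + y), by rw [aQQ, h1], rfl⟩)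
    rw [LinearPMap.isSelfAdjoint_def]
    apply LinearPMap.eq_of_eq_graph
    rw [LinearPMap.adjoint_graph_eq_graph_adjoint hd]
    ext ⟨b, a⟩
    rw [Submodule.mem_adjoint_iff]
    constructor
    · intro h
      have h1 : T b = Q a := by
        refine ext_inner_left ℂ fun z => ?_
        have := h (Q z) (T z) ((memS _ _).mpr ⟨z, rfl, rfl⟩)
        rw [sT, sQ] at this
        exact sub_eq_zero.mp this
      refine (memS _ _).mpr ⟨Q b + T a, ?_, ?_⟩
      · rw [map_add, aQQ, aQT, ← h1, aTT]; abel
      · rw [map_add, aTT, ← aQT, h1, aQQ]; abel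
    · intro h x y hxy
      obtain ⟨z, rfl, rfl⟩ := (memS _ _).mp h
      obtain ⟨w, rfl, rfl⟩ := (memS _ _).mp hxy
      simp only
      rw [sT, sQ, aQT, sub_self]
  · rintro ⟨x, hx⟩
    obtain ⟨z, hz1, hz2⟩ := (memS _ _).mp (g.toLinearPMap.mem_graph ⟨x, hx⟩)
    rw [← hz1, ← hz2, sQ]
    exact pQT z
  · intro x y
    rw [hR]
    constructor
    · intro h
      refine ⟨T (Q (x + y)), (memS _ _).mpr ⟨Q (x + y), ?_, rfl⟩,
        (memS _ _).mpr ⟨T (x + y), aQT _, ?_⟩⟩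
      · rw [aQQ, h]
      · rw [aTT, h]; abel
    · rintro ⟨w, h1, h2⟩
      obtain ⟨a, rfl, rfl⟩ := (memS _ _).mp h1
      obtain ⟨b, hb, rfl⟩ := (memS _ _).mp h2
      have : R (T b) = Q (a - R a) := by
        rw [← aQQ, aQT b, hb, aTT]
      rw [map_add, this, map_sub, ← aQQ, ← aQQ a]
      abel

theorem posSqrt_unique {G S S' : H →ₗ.[ℂ] H} (hG : IsPosSelfAdjoint G)
    (h : IsPosSqrt G S) (h' : IsPosSqrt G S') : S = S' := by
  obtain ⟨R, hR, hR0, hR1⟩ := exists_resolvent hG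
  -- the resolvent of any square root is a fixed function of the resolvent of `G`
  have key : ∀ S, IsPosSqrt G S → ∃ K W : H →L[ℂ] H,
      (∀ x y : H, (x, y) ∈ S.graph ↔ K (x + y) = x) ∧ IsUnit W ∧
      W = 1 + 2 * CFC.sqrt (R * (1 - R)) ∧ K * W = R + CFC.sqrt (R * (1 - R)) := by
    rintro S ⟨hS, hSS⟩
    obtain ⟨K, hK, hK0, hK1⟩ := exists_resolvent hS
    have hK1' : 0 ≤ 1 - K := sub_nonneg.mpr hK1
    have hsK : IsSelfAdjoint K := IsSelfAdjoint.of_nonneg hK0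
    have hspec : ∀ t ∈ spectrum ℝ K, t ∈ Set.Icc (0 : ℝ) 1 := fun t ht =>
      ⟨spectrum_nonneg_of_nonneg hK0 ht, (le_algebraMap_iff_spectrum_le (r := (1 : ℝ))).mp
        (by simpa using hK1) t ht⟩
    set d : ℝ → ℝ := fun t => t ^ 2 + (1 - t) ^ 2 with hd
    have dpos : ∀ t, 0 < d t := fun t => by simp only [hd]; nlinarith [sq_nonneg (2 * t - 1)]
    have cd : Continuous d := by simp only [hd]; fun_prop
    have ci : Continuous fun t => (d t)⁻¹ := cd.inv₀ fun t => (dpos t).ne'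
    have hid : cfc (fun t : ℝ => t) K = K := cfc_id' ℝ K
    have hD : cfc d K = K * K + (1 - K) * (1 - K) := by
      have h1 : (1 : H →L[ℂ] H) - K = cfc (fun t : ℝ => 1 - t) K := by
        rw [cfc_sub _ _ K, hid, cfc_const_one ℝ K]
      have h2 : K * K = cfc (fun t : ℝ => t * t) K := by
        rw [cfc_mul _ _ K, hid]
      rw [h1, h2, ← cfc_mul _ _ K (by fun_prop) (by fun_prop),
        ← cfc_add (a := K) _ _ (by fun_prop) (by fun_prop)]
      refine cfc_congr fun t _ => ?_
      simp only [hd]; ring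
    have hRD : R * cfc d K = K * K := by
      rw [hD]
      ext v
      change R (K (K v) + ((v - K v) - K (v - K v))) = K (K v)
      refine (hR _ _).mp ((hSS _ _).mpr ⟨K v - K (K v), (hK _ _).mpr ?_, (hK _ _).mpr ?_⟩)
      · congr 1; abel
      · rw [map_sub]
        have : K v - K (K v) + (v - K v - (K v - K (K v))) = v - K v := by abel
        rw [this, map_sub]
    have hDW : cfc d K * cfc (fun t => (d t)⁻¹) K = 1 := by
      rw [← cfc_mul _ _ K cd.continuousOn ci.continuousOn, ← cfc_one ℝ K]
      exact cfc_congr fun t _ => mul_inv_cancel₀ (dpos t).ne'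
    have hWD : cfc (fun t => (d t)⁻¹) K * cfc d K = 1 := by
      rw [← cfc_mul _ _ K ci.continuousOn cd.continuousOn, ← cfc_one ℝ K]
      exact cfc_congr fun t _ => inv_mul_cancel₀ (dpos t).ne'
    have hRc : R = cfc (fun t => t * t * (d t)⁻¹) K := by
      rw [cfc_mul _ _ K (by fun_prop) ci.continuousOn, cfc_mul _ _ K, hid, ← hRD, mul_assoc, hDW,
        mul_one]
    have hR1c : 1 - R = cfc (fun t => (1 - t) * (1 - t) * (d t)⁻¹) K := by
      rw [hRc, ← cfc_one ℝ K, ← cfc_sub _ _ K (by fun_prop) (by fun_prop)]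
      refine cfc_congr fun t _ => ?_
      have := (dpos t).ne'
      simp only [Pi.one_apply]
      field_simp
      simp only [hd]; ring
    have hC : CFC.sqrt (R * (1 - R)) = cfc (fun t => t * (1 - t) * (d t)⁻¹) K := by
      refine CFC.sqrt_unique ?_ (cfc_nonneg fun t ht => ?_)
      · rw [hR1c, hRc, ← cfc_mul _ _ K (by fun_prop) (by fun_prop),
          ← cfc_mul _ _ K (by fun_prop) (by fun_prop)]
        exact cfc_congr fun t _ => by ring
      · obtain ⟨h0, h1⟩ := hspec t ht
        exact mul_nonneg (mul_nonneg h0 (by linarith)) (inv_nonneg.mpr (dpos t).le)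
    refine ⟨K, cfc (fun t => (d t)⁻¹) K, hK, ⟨⟨_, _, hWD, hDW⟩, rfl⟩, ?_, ?_⟩
    · rw [hC, two_mul, ← cfc_add (a := K) _ _ (by fun_prop) (by fun_prop), ← cfc_one ℝ K,
        ← cfc_add (a := K) _ _ (by fun_prop) (by fun_prop)]
      refine cfc_congr fun t _ => ?_
      have := (dpos t).ne'
      simp only [Pi.one_apply]
      field_simp
      simp only [hd]; ring
    · rw [hC]
      conv_rhs => rw [hRc]
      rw [← cfc_add (a := K) _ _ (by fun_prop) (by fun_prop)]
      nth_rewrite 1 [← hid]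
      rw [← cfc_mul _ _ K (by fun_prop) ci.continuousOn]
      exact cfc_congr fun t _ => by ring
  obtain ⟨K, W, h1, hW, h2, h3⟩ := key S h
  obtain ⟨K', W', h1', -, h2', h3'⟩ := key S' h'
  have hKK : K = K' := by
    rw [← h2] at h2'
    rw [← h3, h2'] at h3'
    exact (hW.mul_left_injective h3').symm
  apply LinearPMap.eq_of_eq_graph
  ext ⟨x, y⟩
  rw [h1, h1', hKK]

/-- A positive self-adjoint operator has exactly one positive self-adjoint square root. -/
theorem existsUnique_posSqrt {G : H →ₗ.[ℂ] H} (hG : IsPosSelfAdjoint G) :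
    ∃! S, IsPosSqrt G S := by
  obtain ⟨S, hS⟩ := exists_posSqrt hG
  exact ⟨S, hS, fun S' hS' => posSqrt_unique hG hS' hS⟩

theorem existsUnique_spectralProj {G : H →ₗ.[ℂ] H} (hG : IsPosSelfAdjoint G) {n : ℝ}
    (hn : 0 ≤ n) : ∃! P, IsSpectralProj G n P := by
  obtain ⟨R, hR, hR0, hR1⟩ := exists_resolvent hG
  have hn1 : 0 < 1 + n := by linarith
  set a : ℝ := (1 + n)⁻¹ with ha
  have ha0 : 0 < a := inv_pos.mpr hn1
  have hsa : IsSelfAdjoint R := IsSelfAdjoint.of_nonneg hR0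
  have hspec : ∀ t ∈ spectrum ℝ R, 0 ≤ t := fun t ht => spectrum_nonneg_of_nonneg hR0 ht
  set N : H →L[ℂ] H := cfc (fun t : ℝ => max (a - t) 0) R with hN
  set M : H →L[ℂ] H := cfc (fun t : ℝ => max (t - a) 0) R with hM
  set B : H →L[ℂ] H := cfc (fun t : ℝ => (max t a)⁻¹) R with hB
  set L : H →L[ℂ] H := cfc (fun t : ℝ => √(t * max (a - t) 0)) R with hL
  have cB : Continuous fun t : ℝ => (max t a)⁻¹ :=
    Continuous.inv₀ (by fun_prop) fun t => (lt_of_lt_of_le ha0 (le_max_right t a)).ne'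
  have hid : cfc (fun t : ℝ => t) R = R := cfc_id' ℝ R
  have hRB : R * B = 1 - a⁻¹ • N := by
    rw [hB, hN]
    nth_rewrite 1 [← hid]
    rw [← cfc_mul (fun t : ℝ => t) _ R (by fun_prop) cB.continuousOn,
      ← cfc_smul a⁻¹ (fun t : ℝ => max (a - t) 0) R (by fun_prop),
      ← cfc_one ℝ R, ← cfc_sub _ _ R (by fun_prop) (by fun_prop)]
    refine cfc_congr fun t _ => ?_
    simp only [Pi.one_apply, smul_eq_mul]
    rcases le_total t a with h | h
    · rw [max_eq_right h, max_eq_left (by linarith)]; field_simp; ring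
    · rw [max_eq_left h, max_eq_right (by linarith)]
      have : 0 < t := by linarith
      field_simp; ring
  have hRM : R - a • (1 : H →L[ℂ] H) = M - N := by
    rw [hM, hN]
    nth_rewrite 1 [← hid]
    rw [← cfc_one ℝ R, ← cfc_smul a _ R (by fun_prop),
      ← cfc_sub _ _ R (by fun_prop) (by fun_prop), ← cfc_sub _ _ R (by fun_prop) (by fun_prop)]
    refine cfc_congr fun t _ => ?_
    simp only [Pi.one_apply, smul_eq_mul]
    rcases le_total t a with h | h
    · rw [max_eq_right (by linarith), max_eq_left (by linarith)]; ring
    · rw [max_eq_left (by linarith), max_eq_right (by linarith)]; ring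
  have hNM : N * M = 0 := by
    rw [hM, hN, ← cfc_mul _ _ R (by fun_prop) (by fun_prop), ← cfc_zero (R := ℝ) R]
    refine cfc_congr fun t _ => ?_
    simp only [Pi.zero_apply]
    rcases le_total t a with h | h
    · rw [max_eq_right (a := t - a) (by linarith), mul_zero]
    · rw [max_eq_right (a := a - t) (by linarith), zero_mul]
  have hLL : L * L = R * N := by
    rw [hL, hN, ← cfc_mul _ _ R (by fun_prop) (by fun_prop)]
    have h : R * cfc (fun t : ℝ => max (a - t) 0) R = cfc (fun t : ℝ => t * max (a - t) 0) R := by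
      rw [cfc_mul (fun t : ℝ => t) _ R (by fun_prop) (by fun_prop), hid]
    rw [h]
    refine cfc_congr fun t ht => ?_
    exact Real.mul_self_sqrt (mul_nonneg (hspec t ht) (le_max_right _ _))
  have hBle : B ≤ a⁻¹ • (1 : H →L[ℂ] H) := by
    rw [hB, ← Algebra.algebraMap_eq_smul_one]
    refine cfc_le_algebraMap _ _ R (fun t _ => ?_) cB.continuousOn
    exact inv_anti₀ ha0 (le_max_right _ _)
  have cRN : R * N = N * R := by
    have h : Commute R N := ((Commute.refl R).cfc_real _).symm
    exact h
  have cRB : R * B = B * R := by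
    have h : Commute R B := ((Commute.refl R).cfc_real _).symm
    exact h
  have aLL : ∀ z, L (L z) = R (N z) := fun z => congrArg (fun A : H →L[ℂ] H => A z) hLL
  have aNM : ∀ z, N (M z) = 0 := fun z => congrArg (fun A : H →L[ℂ] H => A z) hNM
  have aRN : ∀ z, R (N z) = N (R z) := fun z => congrArg (fun A : H →L[ℂ] H => A z) cRN
  have aRM : ∀ z, R z - a • z = M z - N z := fun z => congrArg (fun A : H →L[ℂ] H => A z) hRM
  have aRB : ∀ z, R (B z) = z - a⁻¹ • N z := fun z => congrArg (fun A : H →L[ℂ] H => A z) hRB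
  have sym : ∀ A : H →L[ℂ] H, IsSelfAdjoint A → ∀ z w, ⟪A z, w⟫_ℂ = ⟪z, A w⟫_ℂ :=
    fun A hA => (ContinuousLinearMap.isSelfAdjoint_iff_isSymmetric.mp hA)
  have sR := sym R hsa
  have sN := sym N (cfc_predicate _ _)
  have sL := sym L (cfc_predicate _ _)
  have mem : ∀ z, (R z, z - R z) ∈ G.graph := fun z => (hR _ _).mpr (by simp)
  have iR : ∀ z, R z = 0 → z = 0 := fun z hz => injective_of_resolvent hR hz
  have val : ∀ (x : G.domain) (y : H), ((x : H), y) ∈ G.graph → G x = y := fun x y h =>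
    LinearPMap.mem_graph_snd_inj G (G.mem_graph x) h rfl
  have nsq : ∀ z : H, (⟪z, z⟫_ℂ).re = ‖z‖ ^ 2 := fun z => by
    rw [inner_self_eq_norm_sq_to_K]; norm_cast
  have hinv : a⁻¹ = 1 + n := by rw [ha, inv_inv]
  -- on the kernel of `N` the operator `G` is defined and at most `n`
  have kerN : ∀ u, N u = 0 → (u, B u - u) ∈ G.graph ∧
      (⟪u, B u - u⟫_ℂ).re ≤ n * ‖u‖ ^ 2 := by
    intro u hu
    refine ⟨(hR _ _).mpr ?_, ?_⟩
    · rw [add_sub_cancel, aRB, hu, smul_zero, sub_zero]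
    · have h1 := ((ContinuousLinearMap.le_def _ _).mp hBle).re_inner_nonneg_right u
      have h2 : (⟪u, (a⁻¹ • (1 : H →L[ℂ] H) - B) u⟫_ℂ).re
          = a⁻¹ * ‖u‖ ^ 2 - (⟪u, B u⟫_ℂ).re := by
        have : (a⁻¹ • (1 : H →L[ℂ] H) - B) u = ((a⁻¹ : ℝ) : ℂ) • u - B u := by
          rw [Complex.coe_smul]; rfl
        rw [this, inner_sub_right, inner_smul_right, Complex.sub_re, Complex.re_ofReal_mul, nsq]
      rw [RCLike.re_to_complex, h2, hinv] at h1
      rw [inner_sub_right, Complex.sub_re, nsq]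
      linarith
  have aRe : ∀ z, a * (⟪R z, z⟫_ℂ).re - ‖R z‖ ^ 2 = ‖L z‖ ^ 2 - (⟪R z, M z⟫_ℂ).re := by
    intro z
    have h1 : ‖L z‖ ^ 2 = (⟪R z, N z⟫_ℂ).re := by rw [← nsq, sL, aLL, sR]
    have h2 := congrArg (fun w => (⟪R z, w⟫_ℂ).re) (aRM z)
    simp only [← Complex.coe_smul, inner_sub_right, inner_smul_right, Complex.sub_re,
      Complex.re_ofReal_mul, nsq] at h2
    linarith
  let K : Submodule ℂ H := N.ker
  have hK : IsClosed (K : Set H) := N.isClosed_ker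
  have : CompleteSpace K := hK.completeSpace_coe
  have memK : ∀ u, u ∈ K ↔ N u = 0 := fun u => Iff.rfl
  let P : H →L[ℂ] H := K.starProjection
  have hP : IsStarProjection P := isStarProjection_starProjection
  have NP : ∀ x, N (P x) = 0 := fun x => (memK _).mp (K.starProjection_apply_mem x)
  have PR : ∀ x, P (R x) = R (P x) := by
    intro x
    refine Submodule.eq_starProjection_of_mem_of_inner_eq_zero ?_ ?_
    · rw [memK, ← aRN, NP, map_zero]
    · intro w hw
      rw [← map_sub, sR]
      refine Submodule.starProjection_inner_eq_zero x (R w) ?_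
      rw [memK, ← aRN, (memK w).mp hw, map_zero]
  have specP : IsSpectralProj G n P := by
    refine ⟨hP, fun x => LinearPMap.mem_domain_of_mem_graph (kerN _ (NP x)).1, ?_, ?_, ?_⟩
    · intro x y h
      rw [hR] at h ⊢
      rw [← map_add, ← PR, h]
    · intro x hx
      have h := kerN x (by rw [← hx]; exact NP x)
      rw [val x _ h.1]
      exact h.2
    · intro x hx hx0
      obtain ⟨y, hy⟩ : ∃ y, ((x : H), y) ∈ G.graph := ⟨_, G.mem_graph x⟩
      rw [val x y hy]
      obtain ⟨z, hz⟩ : ∃ z, (x : H) + y = z := ⟨_, rfl⟩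
      have hRz : R z = x := by rw [← hz]; exact (hR _ _).mp hy
      have hy' : y = z - R z := by rw [hRz, ← hz]; abel
      have h1 := aRe z
      rw [hRz] at h1
      have h2 : ⟪(x : H), M z⟫_ℂ = 0 := by
        have := K.starProjection_inner_eq_zero (x : H) (M z) (aNM z)
        rwa [show K.starProjection (x : H) = 0 from hx, sub_zero] at this
      have h3 : L z ≠ 0 := by
        intro h
        have h4 : N z = 0 := iR _ (by rw [← aLL, h, map_zero])
        have h5 : (x : H) ∈ K := by rw [memK, ← hRz, ← aRN, h4, map_zero]
        exact hx0 ((K.starProjection_eq_self_iff.mpr h5).symm.trans hx)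
      have h4 : 0 < ‖L z‖ ^ 2 := by positivity
      rw [h2, Complex.zero_re, sub_zero] at h1
      rw [hy', inner_sub_right, Complex.sub_re, hRz, nsq]
      have h5 : ‖(x : H)‖ ^ 2 < a * (⟪(x : H), z⟫_ℂ).re := by linarith
      have h6 : a⁻¹ * ‖(x : H)‖ ^ 2 < (⟪(x : H), z⟫_ℂ).re := by
        rw [inv_mul_lt_iff₀ ha0]; exact h5
      rw [hinv] at h6
      linarith
  have fixed : ∀ P' : H →L[ℂ] H, IsSpectralProj G n P' → ∀ u, P' u = u ↔ N u = 0 := by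
    intro P' h' u
    have P'R : ∀ z, P' (R z) = R (P' z) := by
      intro z
      have := (hR _ _).mp (h'.commutes _ _ (mem z))
      rw [← map_add, add_sub_cancel] at this
      exact this.symm
    have cPN : Commute N P' := by
      have h : Commute R P' := by
        ext z
        exact (P'R z).symm
      exact h.cfc_real _
    have P'N : ∀ z, N (P' z) = P' (N z) := fun z => congrArg (fun A : H →L[ℂ] H => A z) cPN
    have P'P' : ∀ z, P' (P' z) = P' z := fun z =>
      congrArg (fun A : H →L[ℂ] H => A z) h'.isStarProjection.isIdempotentElem
    constructor
    · intro hu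
      have hz : P' (N u) = N u := by rw [← P'N, hu]
      have hdom := mem (N u)
      have h1 := h'.le_on_range ⟨R (N u), LinearPMap.mem_domain_of_mem_graph hdom⟩
        (by simp only; rw [P'R, hz])
      rw [val _ _ hdom] at h1
      simp only at h1
      rw [inner_sub_right, Complex.sub_re, nsq] at h1
      have h2 := aRe (N u)
      have h3 : M (N u) = 0 := by
        have : Commute M N := cfc_commute_cfc _ _ R
        have h : M (N u) = N (M u) := congrArg (fun A : H →L[ℂ] H => A u) this
        rw [h, aNM]
      rw [h3, inner_zero_right, Complex.zero_re, sub_zero] at h2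
      have h4 : (⟪R (N u), N u⟫_ℂ).re ≤ a⁻¹ * ‖R (N u)‖ ^ 2 := by rw [hinv]; linarith
      have h5 : a * (⟪R (N u), N u⟫_ℂ).re ≤ ‖R (N u)‖ ^ 2 := by
        rwa [← le_inv_mul_iff₀ ha0]
      have h6 : L (N u) = 0 := by
        have : ‖L (N u)‖ ^ 2 ≤ 0 := by linarith
        simpa using this
      have h7 : N (N u) = 0 := iR _ (by rw [← aLL, h6, map_zero])
      have h8 : ⟪N u, N u⟫_ℂ = 0 := by rw [sN, h7, inner_zero_right]
      exact inner_self_eq_zero.mp h8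
    · intro hu
      by_contra hne
      have h1 : N (u - P' u) = 0 := by rw [map_sub, P'N, hu, map_zero, sub_zero]
      obtain ⟨h2, h3⟩ := kerN _ h1
      have h4 := h'.lt_on_ker ⟨u - P' u, LinearPMap.mem_domain_of_mem_graph h2⟩
        (by simp only; rw [map_sub, P'P', sub_self]) (fun h => hne (sub_eq_zero.mp h).symm)
      rw [val _ _ h2] at h4
      simp only at h4
      linarith
  refine ⟨P, specP, fun P' h' => ?_⟩
  have e1 : P * P' = P' := by
    ext z
    have h := congrArg (fun A : H →L[ℂ] H => A z) h'.isStarProjection.isIdempotentElem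
    exact (fixed P specP _).mpr ((fixed P' h' _).mp h)
  have e2 : P' * P = P := by
    ext z
    have h := congrArg (fun A : H →L[ℂ] H => A z) hP.isIdempotentElem
    exact (fixed P' h' _).mpr ((fixed P specP _).mp h)
  have e3 := congrArg star e2
  rw [star_mul, hP.isSelfAdjoint.star_eq, h'.isStarProjection.isSelfAdjoint.star_eq, e1] at e3
  exact e3

open scoped Classical in
/-- The square root `√G` of a positive self-adjoint operator `G` (the value for other `G` is
irrelevant). -/
noncomputable def posSqrt (G : H →ₗ.[ℂ] H) : H →ₗ.[ℂ] H :=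
  if h : ∃ S, IsPosSqrt G S then h.choose else 0

open scoped Classical in
/-- The spectral projector of a positive self-adjoint operator `G` corresponding to `[0, n]` (the
value for other `G` is irrelevant). -/
noncomputable def spectralProj (G : H →ₗ.[ℂ] H) (n : ℝ) : H →L[ℂ] H :=
  if h : ∃ P, IsSpectralProj G n P then h.choose else 0

theorem posSqrt_spec {G : H →ₗ.[ℂ] H} (hG : IsPosSelfAdjoint G) : IsPosSqrt G (posSqrt G) := by
  rw [posSqrt, dif_pos (exists_posSqrt hG)]
  exact (exists_posSqrt hG).choose_spec

theorem spectralProj_spec {G : H →ₗ.[ℂ] H} (hG : IsPosSelfAdjoint G) {n : ℝ} (hn : 0 ≤ n) :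
    IsSpectralProj G n (spectralProj G n) := by
  have h := (existsUnique_spectralProj hG hn).exists
  rw [spectralProj, dif_pos h]
  exact h.choose_spec

open scoped Classical in
/-- The everywhere defined bounded operator `G Pₙ`, where `Pₙ` is the spectral projector of `G`
corresponding to `[0, n]`; it is the continuous extension of `Pₙ G` from `D(G)` to the whole space.
(For a positive self-adjoint `G` the range of `Pₙ` is contained in `D(G)`, so that only the first
case occurs.) -/
noncomputable def truncation (G : H →ₗ.[ℂ] H) (n : ℝ) (x : H) : H :=
  if h : spectralProj G n x ∈ G.domain then G ⟨spectralProj G n x, h⟩ else 0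

/-- `G` is unbounded. -/
def IsUnbounded (G : H →ₗ.[ℂ] H) : Prop :=
  ¬ ∃ C : ℝ, ∀ x : G.domain, ‖G x‖ ≤ C * ‖(x : H)‖

/-- `G` is discrete: `G = ∑ₖ eₖ |τₖ⟩⟨τₖ|` on the domain `{x | ∑ₖ eₖ² |⟨τₖ, x⟩|² < ∞}`, where `(τₖ)`
is an orthonormal basis and `(eₖ)` is a nondecreasing sequence tending to `+∞`. -/
def IsDiscrete (G : H →ₗ.[ℂ] H) : Prop :=
  ∃ (e : ℕ → ℝ) (τ : HilbertBasis ℕ ℂ H), Monotone e ∧ Filter.Tendsto e Filter.atTop Filter.atTop ∧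
    (∀ x : H, x ∈ G.domain ↔ Summable fun k => e k ^ 2 * ‖⟪τ k, x⟫_ℂ‖ ^ 2) ∧
    ∀ x : G.domain, HasSum (fun k => ((e k : ℂ) * ⟪τ k, (x : H)⟫_ℂ) • τ k) (G x)

/-! ### Trace-class operators and states -/

variable (H) in
/-- The index set of a fixed orthonormal basis of `H`. -/
noncomputable def onbIndex : Set H := (exists_hilbertBasis ℂ H).choose

variable (H) in
/-- A fixed orthonormal basis of `H`, used to compute traces. -/
noncomputable def onb : HilbertBasis (onbIndex H) ℂ H :=
  (exists_hilbertBasis ℂ H).choose_spec.choose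

/-- `T` is trace class: `Tr |T| < ∞`. -/
def IsTraceClass (T : H →L[ℂ] H) : Prop :=
  Summable fun i => (⟪onb H i, CFC.abs T (onb H i)⟫_ℂ).re

/-- The trace `∑ᵢ ⟨bᵢ, T bᵢ⟩`. It is only applied to (the underlying maps of) trace-class operators,
for which the series converges absolutely and does not depend on the orthonormal basis. -/
noncomputable def trace (T : H → H) : ℂ := ∑' i, ⟪onb H i, T (onb H i)⟫_ℂ

variable (H) in
/-- The cone of positive trace-class operators. -/
def posTraceClass : Set (H →L[ℂ] H) := {ρ | ρ.IsPositive ∧ IsTraceClass ρ}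

variable (H) in
/-- The positive trace-class operators with trace at most `1`. -/
def subnormalized : Set (H →L[ℂ] H) := {ρ | ρ ∈ posTraceClass H ∧ (trace ρ).re ≤ 1}

variable (H) in
/-- The states: positive trace-class operators with trace `1`. -/
def states : Set (H →L[ℂ] H) := {ρ | ρ ∈ posTraceClass H ∧ trace ρ = 1}

/-! ### Energy and the operator E-norm -/

open scoped Classical in
/-- `⟨φ|G|φ⟩`, equal to `‖√G φ‖²` if `φ ∈ D(√G)` and to `+∞` otherwise. -/
noncomputable def energy (G : H →ₗ.[ℂ] H) (φ : H) : ℝ≥0∞ :=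
  if h : φ ∈ (posSqrt G).domain then ENNReal.ofReal (‖posSqrt G ⟨φ, h⟩‖ ^ 2) else ∞

/-- `Tr Gρ = supₙ Tr Pₙ G ρ` for a positive trace-class operator `ρ`, where `Pₙ` is the spectral
projector of `G` corresponding to `[0, n]`. Each `Tr Pₙ G ρ` is a nonnegative real number. -/
noncomputable def meanEnergy (G : H →ₗ.[ℂ] H) (ρ : H →L[ℂ] H) : ℝ≥0∞ :=
  ⨆ n : ℕ, ENNReal.ofReal (trace fun x => truncation G n (ρ x)).re

/-- `√(Tr A ρ A⋆)`. -/
noncomputable def sqrtTrace (A ρ : H →L[ℂ] H) : ℝ :=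
  √(trace (A * ρ * star A)).re

/-- The operator E-norm `‖A‖^G_E = sup {‖A φ‖ : ‖φ‖ = 1, ⟨φ|G|φ⟩ ≤ E}`. -/
noncomputable def eNorm (G : H →ₗ.[ℂ] H) (E : ℝ) (A : H →L[ℂ] H) : ℝ :=
  sSup {r | ∃ φ : H, ‖φ‖ = 1 ∧ energy G φ ≤ ENNReal.ofReal E ∧ r = ‖A φ‖}

end OperatorENorm

/-!
Write `S = √G`. Three facts about quadratic forms carry the proof.

*Energy as a limit.* With `Pₙ` the spectral projectors, `⟨ψ|G Pₙ|ψ⟩ = ‖S Pₙ ψ‖²` is a bounded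
quadratic form, it is at most the energy of `ψ`, and it converges to that energy
(`tendsto_truncatedEnergy`): if it stays bounded along a subsequence, then `ψ` lies in the domain of
`S⋆ = S`. Hence, by Fatou's argument and cyclicity of the trace, a positive trace-class `ρ` is a
mixture of the vectors `√ρ bᵢ`, where `b` is the basis used for the trace, with
`∑ᵢ ⟨√ρ bᵢ|G|√ρ bᵢ⟩ ≤ Tr Gρ` (`tsum_energy_le_meanEnergy`) and
`Tr AρA⋆ = ∑ᵢ ‖A √ρ bᵢ‖²` (`trace_conj_mul_self`). For a pure state `|φ⟩⟨φ|` the energies and the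
values agree exactly.

*Convexity.* By the Toeplitz–Hausdorff argument the set of pairs `(‖S φ‖², ‖A φ‖²)`, for unit
vectors `φ`, is convex (`exists_unit_convexCombination`). With `N` the E-norm of `A`, a supporting
line at `(E, N²)` gives `μ, l ≥ 0` with `μ + l E = N²` and
`‖A x‖² ≤ μ ‖x‖² + l ‖S x‖²` on the domain of `S` (`eNorm_lagrange`); here `μ ≥ 0` because `G` has
unit vectors of arbitrarily small energy. This single inequality bounds the supremum over the unit
ball at once and, summed over the vectors `√ρ bᵢ`, the suprema over mixed states. If `G` is
unbounded, convexity also moves a unit vector to energy exactly `E` by mixing in a little of a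
vector of very high energy (`isLUB_eNorm_energy_eq`).

*Compactness.* For discrete `G` the projectors `Pₙ` have finite rank and `n ‖ψ - Pₙ ψ‖²` is at most
the energy of `ψ`, so the unit vectors of energy at most `E` form a compact set
(`isCompact_unit_energy_le`) and a maximizer exists. A maximizer of energy below `E` forces `l = 0`,
whence `‖A‖ ≤ N` (`energy_eq_of_norm_eq_eNorm`).
-/

namespace OperatorENorm

open Filter Topology

/-! ### Spectral truncations and the energy form -/

section

variable {H : Type*} [NormedAddCommGroup H] [InnerProductSpace ℂ H]

theorem re_inner_self (z : H) : (⟪z, z⟫_ℂ).re = ‖z‖ ^ 2 := by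
  rw [inner_self_eq_norm_sq_to_K]; norm_cast

variable [CompleteSpace H]

theorem inner_starProjection_left {P : H →L[ℂ] H} (hP : IsStarProjection P) (x y : H) :
    ⟪P x, y⟫_ℂ = ⟪x, P y⟫_ℂ :=
  ContinuousLinearMap.isSelfAdjoint_iff_isSymmetric.mp hP.isSelfAdjoint x y

theorem starProjection_apply_apply {P : H →L[ℂ] H} (hP : IsStarProjection P) (x : H) :
    P (P x) = P x :=
  congrArg (fun A : H →L[ℂ] H => A x) hP.isIdempotentElem

theorem norm_starProjection_apply_le {P : H →L[ℂ] H} (hP : IsStarProjection P) (x : H) :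
    ‖P x‖ ≤ ‖x‖ :=
  (P.le_of_opNorm_le hP.norm_le x).trans_eq (one_mul _)

theorem energy_of_mem_graph {G : H →ₗ.[ℂ] H} {x z : H} (h : (x, z) ∈ (posSqrt G).graph) :
    energy G x = ENNReal.ofReal (‖z‖ ^ 2) := by
  have hx := LinearPMap.mem_domain_of_mem_graph h
  have : posSqrt G ⟨x, hx⟩ = z :=
    LinearPMap.mem_graph_snd_inj _ ((posSqrt G).mem_graph ⟨x, hx⟩) h rfl
  rw [energy, dif_pos hx, this]

theorem exists_graph_of_energy_ne_top {G : H →ₗ.[ℂ] H} {x : H} (h : energy G x ≠ ∞) :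
    ∃ z, (x, z) ∈ (posSqrt G).graph := by
  by_cases hx : x ∈ (posSqrt G).domain
  · exact LinearPMap.mem_domain_iff.mp hx
  · exact absurd (by rw [energy, dif_neg hx]) h

theorem truncation_mem_graph {G : H →ₗ.[ℂ] H} (hG : IsPosSelfAdjoint G) {n : ℝ} (hn : 0 ≤ n)
    (x : H) : (spectralProj G n x, truncation G n x) ∈ G.graph := by
  have h := (spectralProj_spec hG hn).mem_domain x
  rw [truncation, dif_pos h]
  exact G.mem_graph ⟨_, h⟩

theorem spectralProj_truncation {G : H →ₗ.[ℂ] H} (hG : IsPosSelfAdjoint G) {n : ℝ} (hn : 0 ≤ n)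
    (x : H) : spectralProj G n (truncation G n x) = truncation G n x := by
  have hP := spectralProj_spec hG hn
  have h := hP.commutes _ _ (truncation_mem_graph hG hn x)
  rw [starProjection_apply_apply hP.isStarProjection] at h
  exact LinearPMap.mem_graph_snd_inj _ h (truncation_mem_graph hG hn x) rfl

/-- `G Pₙ` is everywhere defined and symmetric, hence bounded by the Hellinger–Toeplitz theorem. -/
theorem exists_truncation_clm {G : H →ₗ.[ℂ] H} (hG : IsPosSelfAdjoint G) {n : ℝ} (hn : 0 ≤ n) :
    ∃ T : H →L[ℂ] H, (∀ x, T x = truncation G n x) ∧ T.IsPositive := by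
  have hP := spectralProj_spec hG hn
  let T : H →ₗ[ℂ] H :=
    { toFun := truncation G n
      map_add' := fun x y => by
        have h := G.graph.add_mem (truncation_mem_graph hG hn x) (truncation_mem_graph hG hn y)
        rw [Prod.mk_add_mk, ← map_add] at h
        exact LinearPMap.mem_graph_snd_inj _ (truncation_mem_graph hG hn _) h rfl
      map_smul' := fun c x => by
        have h := G.graph.smul_mem c (truncation_mem_graph hG hn x)
        rw [Prod.smul_mk, ← map_smul] at h
        exact LinearPMap.mem_graph_snd_inj _ (truncation_mem_graph hG hn _) h rfl }
  have hT : ∀ x, T x = truncation G n x := fun _ => rfl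
  have hinner : ∀ x y, ⟪x, T y⟫_ℂ = ⟪spectralProj G n x, T y⟫_ℂ := fun x y => by
    rw [inner_starProjection_left hP.isStarProjection, hT, spectralProj_truncation hG hn]
  have hsymm : T.IsSymmetric := fun x y => by
    rw [hinner x y, ← inner_conj_symm, hinner y x, inner_conj_symm, hT, hT]
    exact symm_graph hG (truncation_mem_graph hG hn x) (truncation_mem_graph hG hn y)
  refine ⟨⟨T, hsymm.continuous⟩, hT, ?_⟩
  rw [ContinuousLinearMap.isPositive_def']
  refine ⟨ContinuousLinearMap.isSelfAdjoint_iff_isSymmetric.mpr hsymm, fun x => ?_⟩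
  have h := nonneg_graph hG (truncation_mem_graph hG hn x)
  rw [← hT, ← hinner, ← inner_conj_symm, Complex.conj_re] at h
  exact h

/-- The energy `⟨ψ|G Pₙ|ψ⟩` of a vector below the spectral cutoff `n`. -/
noncomputable def truncatedEnergy (G : H →ₗ.[ℂ] H) (n : ℝ) (ψ : H) : ℝ :=
  (⟪ψ, truncation G n ψ⟫_ℂ).re

theorem continuous_truncatedEnergy {G : H →ₗ.[ℂ] H} (hG : IsPosSelfAdjoint G) {n : ℝ}
    (hn : 0 ≤ n) : Continuous (truncatedEnergy G n) := by
  obtain ⟨T, hT, -⟩ := exists_truncation_clm hG hn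
  have : truncatedEnergy G n = fun ψ => (⟪ψ, T ψ⟫_ℂ).re := by
    funext ψ; rw [truncatedEnergy, hT]
  rw [this]
  fun_prop

theorem truncatedEnergy_nonneg {G : H →ₗ.[ℂ] H} (hG : IsPosSelfAdjoint G) {n : ℝ}
    (hn : 0 ≤ n) (ψ : H) : 0 ≤ truncatedEnergy G n ψ := by
  obtain ⟨T, hT, hT0⟩ := exists_truncation_clm hG hn
  rw [truncatedEnergy, ← hT]
  exact hT0.re_inner_nonneg_right ψ

/-- `⟨ψ|G Pₙ|ψ⟩ = ‖√G Pₙ ψ‖²`. -/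
theorem exists_sqrt_truncatedEnergy {G : H →ₗ.[ℂ] H} (hG : IsPosSelfAdjoint G) {n : ℝ}
    (hn : 0 ≤ n) (ψ : H) : ∃ z, (spectralProj G n ψ, z) ∈ (posSqrt G).graph ∧
      (z, truncation G n ψ) ∈ (posSqrt G).graph ∧ truncatedEnergy G n ψ = ‖z‖ ^ 2 := by
  have hS := posSqrt_spec hG
  have hP := spectralProj_spec hG hn
  obtain ⟨z, h1, h2⟩ := (hS.2 _ _).mp (truncation_mem_graph hG hn ψ)
  refine ⟨z, h1, h2, ?_⟩
  rw [truncatedEnergy, ← spectralProj_truncation hG hn,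
    ← inner_starProjection_left hP.isStarProjection, ← symm_graph hS.1 h1 h2, re_inner_self]

theorem truncatedEnergy_le {G : H →ₗ.[ℂ] H} (hG : IsPosSelfAdjoint G) {n : ℝ}
    (hn : 0 ≤ n) {ψ w : H} (h : (ψ, w) ∈ (posSqrt G).graph) :
    truncatedEnergy G n ψ ≤ ‖w‖ ^ 2 := by
  obtain ⟨z, h1, h2, h3⟩ := exists_sqrt_truncatedEnergy hG hn ψ
  have h4 : truncatedEnergy G n ψ ≤ ‖w‖ * ‖z‖ := by
    rw [truncatedEnergy, ← symm_graph (posSqrt_spec hG).1 h h2]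
    exact re_inner_le_norm (𝕜 := ℂ) _ _
  rw [h3] at h4 ⊢
  nlinarith [sq_nonneg (‖w‖ - ‖z‖), norm_nonneg z, norm_nonneg w]

theorem ofReal_truncatedEnergy_le_energy {G : H →ₗ.[ℂ] H} (hG : IsPosSelfAdjoint G) {n : ℝ}
    (hn : 0 ≤ n) (ψ : H) : ENNReal.ofReal (truncatedEnergy G n ψ) ≤ energy G ψ := by
  by_cases h : energy G ψ = ∞
  · rw [h]; exact le_top
  · obtain ⟨w, hw⟩ := exists_graph_of_energy_ne_top h
    rw [energy_of_mem_graph hw]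
    exact ENNReal.ofReal_le_ofReal (truncatedEnergy_le hG hn hw)

/-- On `D(G)` the part of a vector above the cutoff `n` costs energy at least `n`. -/
theorem cutoff_mul_norm_sub_sq_le_of_mem_graph {G : H →ₗ.[ℂ] H} (hG : IsPosSelfAdjoint G) {n : ℝ}
    (hn : 0 ≤ n) {x y : H} (h : (x, y) ∈ G.graph) :
    n * ‖x - spectralProj G n x‖ ^ 2 ≤ (⟪x - spectralProj G n x, y⟫_ℂ).re := by
  have hP := spectralProj_spec hG hn
  have hs := starProjection_apply_apply hP.isStarProjection
  set u := x - spectralProj G n x with hu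
  have hPu : spectralProj G n u = 0 := by rw [hu, map_sub, hs, sub_self]
  have hg : (u, y - spectralProj G n y) ∈ G.graph := G.graph.sub_mem h (hP.commutes _ _ h)
  have hd := LinearPMap.mem_domain_of_mem_graph hg
  have hGu : G ⟨u, hd⟩ = y - spectralProj G n y :=
    LinearPMap.mem_graph_snd_inj _ (G.mem_graph ⟨u, hd⟩) hg rfl
  have h1 : ⟪u, y - spectralProj G n y⟫_ℂ = ⟪u, y⟫_ℂ := by
    rw [inner_sub_right, ← inner_starProjection_left hP.isStarProjection, hPu, inner_zero_left,
      sub_zero]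
  rw [← h1]
  by_cases hu0 : u = 0
  · simp [hu0]
  · have := hP.lt_on_ker ⟨u, hd⟩ hPu hu0
    rw [hGu] at this
    exact this.le

theorem tendsto_spectralProj {G : H →ₗ.[ℂ] H} (hG : IsPosSelfAdjoint G) (x : H) :
    Tendsto (fun n : ℕ => spectralProj G n x) atTop (𝓝 x) := by
  rw [Metric.tendsto_atTop]
  intro ε hε
  obtain ⟨y, hy, hxy⟩ := Metric.mem_closure_iff.mp (hG.isSelfAdjoint.dense_domain x) (ε / 4)
    (by positivity)
  obtain ⟨v, hv⟩ := LinearPMap.mem_domain_iff.mp hy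
  obtain ⟨N, hN⟩ := exists_nat_gt (‖v‖ / (ε / 4))
  refine ⟨N, fun n hn => ?_⟩
  have hNn : ‖v‖ / (ε / 4) < n := hN.trans_le (by exact_mod_cast hn)
  have hn0 : (0 : ℝ) < n := lt_of_le_of_lt (by positivity) hNn
  have h1 := cutoff_mul_norm_sub_sq_le_of_mem_graph hG hn0.le hv
  have h2 : (⟪y - spectralProj G n y, v⟫_ℂ).re ≤ ‖y - spectralProj G n y‖ * ‖v‖ :=
    re_inner_le_norm (𝕜 := ℂ) _ _
  rw [div_lt_iff₀ (by positivity)] at hNn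
  have h3 : ‖y - spectralProj G n y‖ ≤ ε / 4 := by
    by_contra! hlt
    have hpos : 0 < ‖y - spectralProj G n y‖ := lt_trans (by positivity) hlt
    have h4 : (n : ℝ) * ‖y - spectralProj G n y‖ ≤ ‖v‖ := by
      refine le_of_mul_le_mul_right ?_ hpos
      nlinarith
    nlinarith
  rw [dist_eq_norm] at hxy ⊢
  have h5 : spectralProj G n x - x
      = spectralProj G n (x - y) - (y - spectralProj G n y) - (x - y) := by
    rw [map_sub]; abel
  rw [h5]
  have := norm_sub_le (spectralProj G n (x - y) - (y - spectralProj G n y)) (x - y)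
  have := norm_sub_le (spectralProj G n (x - y)) (y - spectralProj G n y)
  have := norm_starProjection_apply_le
    (spectralProj_spec hG (Nat.cast_nonneg n)).isStarProjection (x - y)
  linarith

/-- If the truncated energies of `ψ` do not tend to infinity, then `ψ ∈ D(√G)`: the vectors
`√G Pₙ ψ` are bounded along a subsequence, so `φ ↦ ⟨ψ, √G φ⟩` is a bounded functional and `ψ`
belongs to the domain of the adjoint of `√G`, which is `√G` itself. -/
theorem exists_graph_of_frequently_truncatedEnergy_le {G : H →ₗ.[ℂ] H} (hG : IsPosSelfAdjoint G)
    {ψ : H} {C : ℝ} (hC : ∃ᶠ n : ℕ in atTop, truncatedEnergy G n ψ ≤ C) :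
    ∃ w, (ψ, w) ∈ (posSqrt G).graph ∧ ‖w‖ ^ 2 ≤ C := by
  have hS := (posSqrt_spec hG).1
  have hC0 : 0 ≤ C := by
    obtain ⟨n, hn⟩ := hC.exists
    exact (truncatedEnergy_nonneg hG (Nat.cast_nonneg n) ψ).trans hn
  have hbd : ∀ a b : H, (a, b) ∈ (posSqrt G).graph → ‖⟪ψ, b⟫_ℂ‖ ≤ √C * ‖a‖ := by
    intro a b hab
    have hlim : Tendsto (fun n : ℕ => ‖⟪spectralProj G n ψ, b⟫_ℂ‖) atTop (𝓝 ‖⟪ψ, b⟫_ℂ‖) :=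
      ((tendsto_spectralProj hG ψ).inner tendsto_const_nhds).norm
    refine isClosed_Iic.mem_of_frequently_of_tendsto (hC.mono fun n hn => ?_) hlim
    obtain ⟨z, h1, -, h3⟩ := exists_sqrt_truncatedEnergy hG (Nat.cast_nonneg n) ψ
    rw [Set.mem_Iic, ← symm_graph hS h1 hab]
    have : ‖z‖ ≤ √C := Real.le_sqrt_of_sq_le (h3 ▸ hn)
    exact (norm_inner_le_norm _ _).trans (by gcongr)
  have hdom : ψ ∈ (posSqrt G).domain := by
    have h := LinearPMap.mem_adjoint_domain_iff (posSqrt G) ψ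
    rw [LinearPMap.isSelfAdjoint_def.mp hS.isSelfAdjoint] at h
    rw [h]
    exact AddMonoidHomClass.continuous_of_bound _ (√C)
      fun x : (posSqrt G).domain => hbd x _ ((posSqrt G).mem_graph x)
  obtain ⟨w, hw⟩ := LinearPMap.mem_domain_iff.mp hdom
  refine ⟨w, hw, ?_⟩
  have hw' : ∀ a : H, ‖⟪w, a⟫_ℂ‖ ≤ √C * ‖a‖ := by
    refine hS.isSelfAdjoint.dense_domain.induction (fun a ha => ?_)
      (isClosed_le (by fun_prop) (by fun_prop))
    obtain ⟨b, hb⟩ := LinearPMap.mem_domain_iff.mp ha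
    rw [symm_graph hS hw hb]
    exact hbd a b hb
  have h1 := hw' w
  rw [inner_self_eq_norm_sq_to_K, norm_pow, RCLike.norm_ofReal,
    abs_norm] at h1
  have h2 : ‖w‖ ≤ √C := by
    by_contra! hlt
    nlinarith [Real.sqrt_nonneg C]
  calc ‖w‖ ^ 2 ≤ √C ^ 2 := by gcongr
    _ = C := Real.sq_sqrt hC0

theorem tendsto_truncatedEnergy {G : H →ₗ.[ℂ] H} (hG : IsPosSelfAdjoint G) (ψ : H) :
    Tendsto (fun n : ℕ => ENNReal.ofReal (truncatedEnergy G n ψ)) atTop (𝓝 (energy G ψ)) := by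
  refine tendsto_order.mpr ⟨fun c hc => ?_, fun c hc => Eventually.of_forall fun n =>
    (ofReal_truncatedEnergy_le_energy hG (Nat.cast_nonneg n) ψ).trans_lt hc⟩
  by_contra hne
  have hct : c ≠ ∞ := hc.ne_top
  obtain ⟨w, hw, hwC⟩ := exists_graph_of_frequently_truncatedEnergy_le hG (C := c.toReal)
    ((not_eventually.mp hne).mono fun n hn =>
      (ENNReal.ofReal_le_iff_le_toReal hct).mp (not_lt.mp hn))
  rw [energy_of_mem_graph hw] at hc
  exact absurd hc (not_lt.mpr ((ENNReal.ofReal_le_iff_le_toReal hct).mpr hwC))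

theorem iSup_truncatedEnergy {G : H →ₗ.[ℂ] H} (hG : IsPosSelfAdjoint G) (ψ : H) :
    ⨆ n : ℕ, ENNReal.ofReal (truncatedEnergy G n ψ) = energy G ψ :=
  le_antisymm (iSup_le fun n => ofReal_truncatedEnergy_le_energy hG (Nat.cast_nonneg n) ψ)
    (le_of_tendsto' (tendsto_truncatedEnergy hG ψ) fun n => le_iSup
      (fun n : ℕ => ENNReal.ofReal (truncatedEnergy G n ψ)) n)

/-- The bound extends from `D(G)` to `D(√G)` along the vectors `Pₘ ψ`. -/
theorem cutoff_mul_norm_sub_sq_le {G : H →ₗ.[ℂ] H} (hG : IsPosSelfAdjoint G) {n : ℝ}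
    (hn : 0 ≤ n) {ψ w : H} (h : (ψ, w) ∈ (posSqrt G).graph) :
    n * ‖ψ - spectralProj G n ψ‖ ^ 2 ≤ ‖w‖ ^ 2 := by
  have hP := spectralProj_spec hG hn
  have hlim : Tendsto (fun m : ℕ => n * ‖spectralProj G m ψ -
      spectralProj G n (spectralProj G m ψ)‖ ^ 2) atTop
      (𝓝 (n * ‖ψ - spectralProj G n ψ‖ ^ 2)) := by
    have h1 := tendsto_spectralProj hG ψ
    have h2 := ((spectralProj G n).continuous.tendsto ψ).comp h1
    exact ((h1.sub h2).norm.pow 2).const_mul n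
  refine le_of_tendsto' hlim fun m => ?_
  have hm : (0 : ℝ) ≤ m := Nat.cast_nonneg m
  have hg := truncation_mem_graph hG hm ψ
  refine (cutoff_mul_norm_sub_sq_le_of_mem_graph hG hn hg).trans
    (le_trans ?_ (truncatedEnergy_le hG hm h))
  set x := spectralProj G m ψ
  have h1 : truncatedEnergy G m ψ = (⟪x, truncation G m ψ⟫_ℂ).re := by
    rw [truncatedEnergy, ← spectralProj_truncation hG hm,
      ← inner_starProjection_left (spectralProj_spec hG hm).isStarProjection,
      spectralProj_truncation hG hm]
  have h2 : 0 ≤ (⟪spectralProj G n x, truncation G m ψ⟫_ℂ).re := by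
    have h3 := nonneg_graph hG (hP.commutes _ _ hg)
    rwa [← inner_starProjection_left hP.isStarProjection,
      starProjection_apply_apply hP.isStarProjection] at h3
  rw [h1, inner_sub_left, Complex.sub_re]
  linarith

end

/-! ### Hilbert–Schmidt norms and traces -/

section

variable {H : Type*} [NormedAddCommGroup H] [InnerProductSpace ℂ H]

theorem hasSum_norm_inner_sq {ι : Type*} (b : HilbertBasis ι ℂ H) (x : H) :
    HasSum (fun i => ‖⟪b i, x⟫_ℂ‖ ^ 2) (‖x‖ ^ 2) := by
  have h := Complex.hasSum_re (b.hasSum_inner_mul_inner x x)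
  rw [re_inner_self] at h
  refine h.congr_fun fun i => ?_
  rw [← inner_conj_symm x (b i), ← Complex.normSq_eq_conj_mul_self, Complex.ofReal_re,
    Complex.normSq_eq_norm_sq]

theorem enorm_sq_eq_ofReal {F : Type*} [NormedAddCommGroup F] (x : F) :
    ‖x‖ₑ ^ 2 = ENNReal.ofReal (‖x‖ ^ 2) := by
  rw [← ofReal_norm, ENNReal.ofReal_pow (norm_nonneg _)]

theorem tsum_enorm_inner_sq {ι : Type*} (b : HilbertBasis ι ℂ H) (x : H) :
    ∑' i, ‖⟪b i, x⟫_ℂ‖ₑ ^ 2 = ‖x‖ₑ ^ 2 := by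
  have h := hasSum_norm_inner_sq b x
  simp_rw [enorm_sq_eq_ofReal]
  rw [← ENNReal.ofReal_tsum_of_nonneg (fun _ => by positivity) h.summable, h.tsum_eq]

theorem inner_mul_self_apply {S : H →L[ℂ] H} (hS : S.IsPositive) (x : H) :
    ⟪x, (S * S) x⟫_ℂ = (‖S x‖ ^ 2 : ℝ) := by
  have : ⟪x, (S * S) x⟫_ℂ = ⟪S x, S x⟫_ℂ := (hS.inner_left_eq_inner_right x (S x)).symm
  rw [this, inner_self_eq_norm_sq_to_K]; norm_cast

variable [CompleteSpace H]

/-- The squared Hilbert–Schmidt norm `∑ᵢ ‖X bᵢ‖²`, with value `∞` if `X` is not Hilbert–Schmidt. -/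
noncomputable def hilbertSchmidtSq (X : H →L[ℂ] H) : ℝ≥0∞ := ∑' i, ‖X (onb H i)‖ₑ ^ 2

theorem hilbertSchmidtSq_eq_tsum_tsum (X : H →L[ℂ] H) :
    hilbertSchmidtSq X = ∑' i, ∑' j, ‖⟪onb H j, X (onb H i)⟫_ℂ‖ₑ ^ 2 := by
  simp_rw [tsum_enorm_inner_sq]; rfl

theorem hilbertSchmidtSq_star (X : H →L[ℂ] H) : hilbertSchmidtSq (star X) = hilbertSchmidtSq X := by
  rw [hilbertSchmidtSq_eq_tsum_tsum, hilbertSchmidtSq_eq_tsum_tsum, ENNReal.tsum_comm]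
  refine tsum_congr fun i => tsum_congr fun j => ?_
  rw [ContinuousLinearMap.star_eq_adjoint, ContinuousLinearMap.adjoint_inner_right,
    ← inner_conj_symm, ← ofReal_norm, ← ofReal_norm, RCLike.norm_conj]

theorem hilbertSchmidtSq_mul_ne_top (T : H →L[ℂ] H) {X : H →L[ℂ] H}
    (hX : hilbertSchmidtSq X ≠ ∞) : hilbertSchmidtSq (T * X) ≠ ∞ := by
  refine ne_top_of_le_ne_top (b := ‖T‖ₑ ^ 2 * hilbertSchmidtSq X)
    (ENNReal.mul_ne_top (by simp) hX) ?_
  rw [hilbertSchmidtSq, hilbertSchmidtSq, ← ENNReal.tsum_mul_left]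
  refine ENNReal.tsum_le_tsum fun i => ?_
  rw [← mul_pow]
  exact pow_le_pow_left' (T.le_opENorm _) 2

theorem summable_norm_inner_sq {X : H →L[ℂ] H} (hX : hilbertSchmidtSq X ≠ ∞) :
    Summable fun p : onbIndex H × onbIndex H => ‖⟪onb H p.2, X (onb H p.1)⟫_ℂ‖ ^ 2 := by
  rw [hilbertSchmidtSq_eq_tsum_tsum,
    ← ENNReal.tsum_prod (f := fun i j => ‖⟪onb H j, X (onb H i)⟫_ℂ‖ₑ ^ 2)] at hX
  refine (ENNReal.summable_toReal hX).congr fun p => ?_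
  rw [ENNReal.toReal_pow, toReal_enorm]

/-- Cyclicity of the trace for Hilbert–Schmidt operators: the double series over matrix entries
converges absolutely. -/
theorem trace_mul_comm {X Y : H →L[ℂ] H} (hX : hilbertSchmidtSq X ≠ ∞)
    (hY : hilbertSchmidtSq Y ≠ ∞) : trace (X * Y : H →L[ℂ] H) = trace (Y * X : H →L[ℂ] H) := by
  have hexp : ∀ (U V : H →L[ℂ] H) (i : onbIndex H), ⟪onb H i, (U * V) (onb H i)⟫_ℂ
      = ∑' j, ⟪onb H i, U (onb H j)⟫_ℂ * ⟪onb H j, V (onb H i)⟫_ℂ := by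
    intro U V i
    have h := (onb H).tsum_inner_mul_inner (star U (onb H i)) (V (onb H i))
    simp_rw [ContinuousLinearMap.star_eq_adjoint, ContinuousLinearMap.adjoint_inner_left] at h
    exact h.symm
  have hs : Summable (Function.uncurry fun i j =>
      ⟪onb H i, X (onb H j)⟫_ℂ * ⟪onb H j, Y (onb H i)⟫_ℂ) := by
    refine Summable.of_norm_bounded
      ((summable_norm_inner_sq hX).prod_symm.add (summable_norm_inner_sq hY)) fun p => ?_
    rw [Function.uncurry_def, norm_mul]
    simp only [Prod.fst_swap, Prod.snd_swap]
    nlinarith [sq_nonneg (‖⟪onb H p.1, X (onb H p.2)⟫_ℂ‖ - ‖⟪onb H p.2, Y (onb H p.1)⟫_ℂ‖),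
      sq_nonneg (‖⟪onb H p.1, X (onb H p.2)⟫_ℂ‖ + ‖⟪onb H p.2, Y (onb H p.1)⟫_ℂ‖)]
  simp_rw [trace, hexp]
  exact hs.tsum_comm.symm.trans (tsum_congr fun i => tsum_congr fun j => mul_comm _ _)

/-- No convergence is required: if `X` is not Hilbert–Schmidt, both sides are `0`. -/
theorem trace_eq_hilbertSchmidtSq {F : H → H} {X : H →L[ℂ] H}
    (h : ∀ x, ⟪x, F x⟫_ℂ = (‖X x‖ ^ 2 : ℝ)) : trace F = ((hilbertSchmidtSq X).toReal : ℂ) := by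
  simp_rw [trace, h]
  rw [← Complex.ofReal_tsum, hilbertSchmidtSq, ENNReal.tsum_toReal_eq (by simp)]
  simp [ENNReal.toReal_pow, toReal_enorm]

theorem exists_isPositive_mul_self {ρ : H →L[ℂ] H} (hρ : ρ.IsPositive) :
    ∃ S : H →L[ℂ] H, S.IsPositive ∧ S * S = ρ :=
  ⟨CFC.sqrt ρ, (ContinuousLinearMap.nonneg_iff_isPositive _).mp (CFC.sqrt_nonneg _),
    CFC.sqrt_mul_sqrt_self ρ ((ContinuousLinearMap.nonneg_iff_isPositive _).mpr hρ)⟩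

theorem abs_eq_self_of_isPositive {ρ : H →L[ℂ] H} (hρ : ρ.IsPositive) : CFC.abs ρ = ρ :=
  CFC.abs_of_nonneg ρ ((ContinuousLinearMap.nonneg_iff_isPositive _).mpr hρ)

theorem hilbertSchmidtSq_ne_top {S : H →L[ℂ] H} (hS : S.IsPositive)
    (h : S * S ∈ posTraceClass H) : hilbertSchmidtSq S ≠ ∞ := by
  have h2 := h.2
  rw [IsTraceClass, abs_eq_self_of_isPositive h.1] at h2
  simp_rw [inner_mul_self_apply hS, Complex.ofReal_re] at h2
  rw [hilbertSchmidtSq]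
  simp_rw [enorm_sq_eq_ofReal]
  rw [← ENNReal.ofReal_tsum_of_nonneg (fun _ => by positivity) h2]
  exact ENNReal.ofReal_ne_top

theorem trace_conj_mul_self {S : H →L[ℂ] H} (hS : S.IsPositive) (A : H →L[ℂ] H) :
    trace (A * (S * S) * star A : H →L[ℂ] H) = ((hilbertSchmidtSq (A * S)).toReal : ℂ) := by
  have hSs : star S = S := hS.isSelfAdjoint.star_eq
  rw [← hilbertSchmidtSq_star, star_mul, hSs]
  refine trace_eq_hilbertSchmidtSq fun x => ?_
  have h : ⟪x, (A * (S * S) * star A) x⟫_ℂ = ⟪star A x, (S * S) (star A x)⟫_ℂ := by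
    rw [ContinuousLinearMap.star_eq_adjoint, ContinuousLinearMap.adjoint_inner_left]; rfl
  rw [h, inner_mul_self_apply hS]; rfl

/-! ### The mean energy of mixed and pure states -/

/-- Cyclicity turns `Tr Pₙ G S²` into `Tr S Pₙ G S`, a sum of truncated energies. -/
theorem ofReal_trace_truncation {G : H →ₗ.[ℂ] H} (hG : IsPosSelfAdjoint G) {n : ℝ} (hn : 0 ≤ n)
    {S : H →L[ℂ] H} (hS : S.IsPositive) (hSfin : hilbertSchmidtSq S ≠ ∞) :
    ENNReal.ofReal (trace fun x => truncation G n ((S * S) x)).re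
      = ∑' i, ENNReal.ofReal (truncatedEnergy G n (S (onb H i))) := by
  obtain ⟨T, hT, hT0⟩ := exists_truncation_clm hG hn
  obtain ⟨V, hV, rfl⟩ := exists_isPositive_mul_self hT0
  have h1 : (fun x => truncation G n ((S * S) x)) = ((V * V * S) * S : H →L[ℂ] H) := by
    funext x; rw [← hT]; rfl
  have h2 : trace (S * (V * V * S) : H →L[ℂ] H) = ((hilbertSchmidtSq (V * S)).toReal : ℂ) := by
    refine trace_eq_hilbertSchmidtSq fun x => ?_
    have h : ⟪x, (S * (V * V * S)) x⟫_ℂ = ⟪S x, (V * V) (S x)⟫_ℂ :=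
      (hS.inner_left_eq_inner_right x _).symm
    rw [h, inner_mul_self_apply hV]; rfl
  rw [h1, trace_mul_comm (hilbertSchmidtSq_mul_ne_top _ hSfin) hSfin, h2, Complex.ofReal_re,
    ENNReal.ofReal_toReal (hilbertSchmidtSq_mul_ne_top _ hSfin), hilbertSchmidtSq]
  refine tsum_congr fun i => ?_
  rw [enorm_sq_eq_ofReal, truncatedEnergy, ← hT, inner_mul_self_apply hV, Complex.ofReal_re]
  rfl

/-- If `ρ = S²` with `S ≥ 0`, then `ρ` is a mixture of the vectors `S bᵢ`, and `Tr Gρ` is at least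
the sum of their energies. -/
theorem tsum_energy_le_meanEnergy {G : H →ₗ.[ℂ] H} (hG : IsPosSelfAdjoint G)
    {S : H →L[ℂ] H} (hS : S.IsPositive) (hSfin : hilbertSchmidtSq S ≠ ∞) :
    ∑' i, energy G (S (onb H i)) ≤ meanEnergy G (S * S) := by
  rw [ENNReal.tsum_eq_iSup_sum, meanEnergy]
  refine iSup_le fun F => le_of_tendsto' (tendsto_finsetSum F fun i _ =>
    tendsto_truncatedEnergy hG (S (onb H i))) fun n => ?_
  refine le_trans ?_ (le_iSup (fun n : ℕ =>
    ENNReal.ofReal (trace fun x => truncation G n ((S * S) x)).re) n)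
  rw [ofReal_trace_truncation hG (Nat.cast_nonneg n) hS hSfin]
  exact ENNReal.sum_le_tsum F

open InnerProductSpace in
theorem trace_rankOne (x y : H) : trace (rankOne ℂ x y) = ⟪y, x⟫_ℂ := by
  rw [trace, ← (onb H).tsum_inner_mul_inner]
  refine tsum_congr fun i => ?_
  rw [rankOne_apply, inner_smul_right]

open InnerProductSpace in
theorem rankOne_mem_states {φ : H} (hφ : ‖φ‖ = 1) : rankOne ℂ φ φ ∈ states H := by
  refine ⟨⟨isPositive_rankOne_self φ, ?_⟩, ?_⟩
  · rw [IsTraceClass, abs_eq_self_of_isPositive (isPositive_rankOne_self φ)]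
    refine (Complex.hasSum_re ((onb H).hasSum_inner_mul_inner φ φ)).summable.congr fun i => ?_
    rw [rankOne_apply, inner_smul_right]
  · rw [trace_rankOne, inner_self_eq_norm_sq_to_K, hφ]; simp

open InnerProductSpace in
theorem meanEnergy_rankOne {G : H →ₗ.[ℂ] H} (hG : IsPosSelfAdjoint G) (φ : H) :
    meanEnergy G (rankOne ℂ φ φ) = energy G φ := by
  rw [← iSup_truncatedEnergy hG, meanEnergy]
  refine iSup_congr fun n => ?_
  obtain ⟨T, hT, -⟩ := exists_truncation_clm hG (Nat.cast_nonneg n)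
  have : (fun x => truncation G n (rankOne ℂ φ φ x)) = rankOne ℂ (T φ) φ := by
    funext x; rw [← hT, rankOne_apply, rankOne_apply, map_smul]
  rw [this, trace_rankOne, truncatedEnergy, hT]

open InnerProductSpace in
theorem sqrtTrace_rankOne (A : H →L[ℂ] H) (φ : H) : sqrtTrace A (rankOne ℂ φ φ) = ‖A φ‖ := by
  have : A * rankOne ℂ φ φ * star A = rankOne ℂ (A φ) (A φ) := by
    ext x
    change A (⟪φ, star A x⟫_ℂ • φ) = ⟪A φ, x⟫_ℂ • A φ
    rw [map_smul, ContinuousLinearMap.star_eq_adjoint, ContinuousLinearMap.adjoint_inner_right]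
  rw [sqrtTrace, this, trace_rankOne, re_inner_self, Real.sqrt_sq (norm_nonneg _)]

/-- A quadratic bound of `A` by the energy form on vectors passes to mixed states, by summation over
the vectors `√ρ bᵢ`. -/
theorem trace_conj_le_of_forall {G : H →ₗ.[ℂ] H} (hG : IsPosSelfAdjoint G) {A ρ : H →L[ℂ] H}
    {μ l E : ℝ} (hμ : 0 ≤ μ) (hl : 0 ≤ l) (hE : 0 ≤ E)
    (hA : ∀ x z, (x, z) ∈ (posSqrt G).graph → ‖A x‖ ^ 2 ≤ μ * ‖x‖ ^ 2 + l * ‖z‖ ^ 2)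
    (hρ : ρ ∈ subnormalized H) (hρE : meanEnergy G ρ ≤ ENNReal.ofReal E) :
    (trace (A * ρ * star A : H →L[ℂ] H)).re ≤ μ + l * E := by
  obtain ⟨S, hS, rfl⟩ := exists_isPositive_mul_self hρ.1.1
  have hSfin := hilbertSchmidtSq_ne_top hS hρ.1
  have h1 : hilbertSchmidtSq S ≤ 1 := by
    have h := hρ.2
    rw [trace_eq_hilbertSchmidtSq (inner_mul_self_apply hS), Complex.ofReal_re] at h
    rw [← ENNReal.ofReal_toReal hSfin]
    exact (ENNReal.ofReal_le_ofReal h).trans_eq ENNReal.ofReal_one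
  have h2 := (tsum_energy_le_meanEnergy hG hS hSfin).trans hρE
  have h3 : ∀ i, ‖A (S (onb H i))‖ₑ ^ 2
      ≤ ENNReal.ofReal μ * ‖S (onb H i)‖ₑ ^ 2 + ENNReal.ofReal l * energy G (S (onb H i)) := by
    intro i
    have hfin : energy G (S (onb H i)) ≠ ∞ :=
      ne_top_of_le_ne_top ENNReal.ofReal_ne_top ((ENNReal.le_tsum i).trans h2)
    obtain ⟨z, hz⟩ := exists_graph_of_energy_ne_top hfin
    rw [energy_of_mem_graph hz, enorm_sq_eq_ofReal, enorm_sq_eq_ofReal, ← ENNReal.ofReal_mul hμ,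
      ← ENNReal.ofReal_mul hl, ← ENNReal.ofReal_add (by positivity) (by positivity)]
    exact ENNReal.ofReal_le_ofReal (hA _ _ hz)
  have h4 : hilbertSchmidtSq (A * S) ≤ ENNReal.ofReal (μ + l * E) := by
    calc hilbertSchmidtSq (A * S)
        ≤ ∑' i, (ENNReal.ofReal μ * ‖S (onb H i)‖ₑ ^ 2
            + ENNReal.ofReal l * energy G (S (onb H i))) := ENNReal.tsum_le_tsum h3
      _ = ENNReal.ofReal μ * hilbertSchmidtSq S
            + ENNReal.ofReal l * ∑' i, energy G (S (onb H i)) := by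
          rw [ENNReal.tsum_add, ENNReal.tsum_mul_left, ENNReal.tsum_mul_left]; rfl
      _ ≤ ENNReal.ofReal μ * 1 + ENNReal.ofReal l * ENNReal.ofReal E := by gcongr
      _ = ENNReal.ofReal (μ + l * E) := by
          rw [mul_one, ← ENNReal.ofReal_mul hl, ← ENNReal.ofReal_add hμ (by positivity)]
  rw [trace_conj_mul_self hS, Complex.ofReal_re]
  exact ENNReal.toReal_le_of_le_ofReal (by positivity) h4

end

/-! ### Joint convexity of two quadratic forms on the unit sphere -/

theorem norm_sq_segment_smul {W : Type*} [NormedAddCommGroup W] [InnerProductSpace ℂ W] {z : ℂ}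
    (hz : ‖z‖ = 1) (x y : W) (r : ℝ) :
    ‖((1 - r : ℝ) : ℂ) • x + (r : ℂ) • (z • y)‖ ^ 2
      = (1 - r) ^ 2 * ‖x‖ ^ 2 + 2 * ((1 - r) * r) * (z * ⟪x, y⟫_ℂ).re + r ^ 2 * ‖y‖ ^ 2 := by
  rw [norm_add_sq (𝕜 := ℂ), norm_smul, norm_smul, norm_smul, hz, inner_smul_left,
    inner_smul_right, inner_smul_right, Complex.conj_ofReal]
  rw [Complex.norm_real, Complex.norm_real, RCLike.re_to_complex, Complex.re_ofReal_mul,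
    Complex.re_ofReal_mul, one_mul, mul_pow, mul_pow, Real.norm_eq_abs, Real.norm_eq_abs,
    sq_abs, sq_abs]
  ring

/-- A form of the Toeplitz–Hausdorff theorem: the joint range of two quadratic forms `‖A w‖²`,
`‖S w‖²` on the unit sphere of a complex inner product space is convex. The affine function `h`
that vanishes at both given points of the range is homogenized to a Hermitian form; after a change
of phase its cross term vanishes, so it vanishes on the whole real span of `u` and `v`, and the
intermediate value theorem reaches every point of the segment. -/
theorem exists_unit_convexCombination {V F : Type*} [NormedAddCommGroup V]
    [InnerProductSpace ℂ V] [NormedAddCommGroup F] [InnerProductSpace ℂ F]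
    (A S : V →ₗ[ℂ] F) {u v : V} (hu : ‖u‖ = 1) (hv : ‖v‖ = 1) (hS : ‖S u‖ ^ 2 ≠ ‖S v‖ ^ 2)
    {t : ℝ} (ht : t ∈ Set.Icc (0 : ℝ) 1) :
    ∃ w, ‖w‖ = 1 ∧ ‖S w‖ ^ 2 = (1 - t) * ‖S u‖ ^ 2 + t * ‖S v‖ ^ 2 ∧
      ‖A w‖ ^ 2 = (1 - t) * ‖A u‖ ^ 2 + t * ‖A v‖ ^ 2 := by
  set d := ‖S v‖ ^ 2 - ‖S u‖ ^ 2 with hd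
  have hd0 : d ≠ 0 := sub_ne_zero.mpr hS.symm
  set s := (‖A v‖ ^ 2 - ‖A u‖ ^ 2) / d with hs
  have hsd : s * d = ‖A v‖ ^ 2 - ‖A u‖ ^ 2 := div_mul_cancel₀ _ hd0
  -- `k = ‖A u‖² - s ‖S u‖²`, so that `h w = ‖A w‖² - s ‖S w‖² - k ‖w‖²` vanishes at `u` and `v`
  set k := ‖A u‖ ^ 2 - s * ‖S u‖ ^ 2 with hk
  set c : ℂ := ⟪A u, A v⟫_ℂ - s * ⟪S u, S v⟫_ℂ - k * ⟪u, v⟫_ℂ with hc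
  obtain ⟨z, hz1, hz2⟩ : ∃ z : ℂ, ‖z‖ = 1 ∧ (z * c).re = 0 := by
    by_cases hc0 : c = 0
    · exact ⟨1, by simp, by simp [hc0]⟩
    · have hn : (‖c‖ : ℂ) ≠ 0 := by simpa using hc0
      refine ⟨Complex.I * (starRingEnd ℂ) c / ‖c‖, ?_, ?_⟩
      · simp [hc0]
      · have : Complex.I * (starRingEnd ℂ) c / ‖c‖ * c = (‖c‖ : ℂ) * Complex.I := by
          have h := Complex.conj_mul' c
          field_simp
          linear_combination h
        rw [this, Complex.re_ofReal_mul, Complex.I_re, mul_zero]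
  let p : ℝ → V := fun r => ((1 - r : ℝ) : ℂ) • u + (r : ℂ) • (z • v)
  have pS : ∀ r, S (p r) = ((1 - r : ℝ) : ℂ) • S u + (r : ℂ) • (z • S v) := fun r => by
    simp only [p, map_add, map_smul]
  have pA : ∀ r, A (p r) = ((1 - r : ℝ) : ℂ) • A u + (r : ℂ) • (z • A v) := fun r => by
    simp only [p, map_add, map_smul]
  have nS := fun r => norm_sq_segment_smul hz1 (S u) (S v) r
  have nA := fun r => norm_sq_segment_smul hz1 (A u) (A v) r
  have nV := fun r => norm_sq_segment_smul hz1 u v r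
  simp only [← pS] at nS
  simp only [← pA] at nA
  change ∀ r, ‖p r‖ ^ 2 = _ at nV
  have hcross : (z * ⟪A u, A v⟫_ℂ).re - s * (z * ⟪S u, S v⟫_ℂ).re - k * (z * ⟪u, v⟫_ℂ).re = 0 := by
    rw [← hz2, hc, ← Complex.re_ofReal_mul, ← Complex.re_ofReal_mul, ← Complex.sub_re,
      ← Complex.sub_re]
    congr 1; ring
  have hline : ∀ r, ‖A (p r)‖ ^ 2 = s * ‖S (p r)‖ ^ 2 + k * ‖p r‖ ^ 2 := by
    intro r
    rw [nS, nA, nV, hu, hv]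
    have h1 : ‖A v‖ ^ 2 = s * ‖S v‖ ^ 2 + k := by rw [hk]; linear_combination -hsd + s * hd
    have h2 : ‖A u‖ ^ 2 = s * ‖S u‖ ^ 2 + k := by rw [hk]; ring
    linear_combination (1 - r) ^ 2 * h2 + 2 * ((1 - r) * r) * hcross + r ^ 2 * h1
  -- the segment avoids `0`, since otherwise `u` and `v` would be proportional
  have hp0 : ∀ r, p r ≠ 0 := by
    intro r hr
    have e1 : ((1 - r : ℝ) : ℂ) • u = -((r : ℂ) • (z • v)) := eq_neg_of_add_eq_zero_left hr
    have e2 : ((1 - r : ℝ) : ℂ) • S u = -((r : ℂ) • (z • S v)) := by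
      have := congrArg S e1
      simpa only [map_smul, map_neg] using this
    have e3 := congrArg norm e1
    have e4 := congrArg norm e2
    rw [norm_neg, norm_smul, norm_smul, norm_smul, hz1, Complex.norm_real, Complex.norm_real,
      hu, hv, one_mul, mul_one, mul_one] at e3
    rw [norm_neg, norm_smul, norm_smul, norm_smul, hz1, Complex.norm_real, Complex.norm_real,
      one_mul, e3] at e4
    have hr0 : ‖r‖ ≠ 0 := by
      intro h
      rw [h] at e3
      rw [norm_eq_zero] at h e3
      rw [h] at e3
      norm_num at e3
    exact hS (by rw [mul_left_cancel₀ hr0 e4])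
  have hcont : Continuous fun r => ‖S (p r)‖ ^ 2 / ‖p r‖ ^ 2 := by
    refine Continuous.div₀ ?_ ?_ fun r => pow_ne_zero 2 (norm_ne_zero_iff.mpr (hp0 r))
    · simp only [pS]; fun_prop
    · simp only [p]; fun_prop
  obtain ⟨r, hr⟩ : ∃ r, ‖S (p r)‖ ^ 2 / ‖p r‖ ^ 2 = (1 - t) * ‖S u‖ ^ 2 + t * ‖S v‖ ^ 2 := by
    have hmem : (1 - t) * ‖S u‖ ^ 2 + t * ‖S v‖ ^ 2 ∈ Set.uIcc (‖S (p 0)‖ ^ 2 / ‖p 0‖ ^ 2)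
        (‖S (p 1)‖ ^ 2 / ‖p 1‖ ^ 2) := by
      rw [nS, nS, nV, nV, hu, hv]
      norm_num
      rw [Set.mem_uIcc]
      obtain ⟨h0, h1⟩ := ht
      rcases le_total (‖S u‖ ^ 2) (‖S v‖ ^ 2) with h | h
      · exact Or.inl ⟨by nlinarith, by nlinarith⟩
      · exact Or.inr ⟨by nlinarith, by nlinarith⟩
    obtain ⟨r, -, hr⟩ := intermediate_value_uIcc (a := (0 : ℝ)) (b := 1) hcont.continuousOn hmem
    exact ⟨r, hr⟩
  have hpr : ‖p r‖ ≠ 0 := norm_ne_zero_iff.mpr (hp0 r)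
  have hnorm : ∀ x : F, ‖((‖p r‖⁻¹ : ℝ) : ℂ) • x‖ ^ 2 = ‖x‖ ^ 2 / ‖p r‖ ^ 2 := by
    intro x
    rw [norm_smul, Complex.norm_real, norm_inv, norm_norm, mul_pow, inv_pow, div_eq_inv_mul]
  refine ⟨((‖p r‖⁻¹ : ℝ) : ℂ) • p r, ?_, ?_, ?_⟩
  · rw [norm_smul, Complex.norm_real, norm_inv, norm_norm, inv_mul_cancel₀ hpr]
  · rw [map_smul, hnorm, hr]
  · rw [map_smul, hnorm, hline, add_div, mul_div_assoc, hr, mul_div_assoc,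
      div_self (pow_ne_zero 2 hpr), hk]
    linear_combination t * hsd - t * s * hd

/-- Lagrange duality for the maximization of `‖A φ‖²` over unit vectors with `‖S φ‖² ≤ E`: by
convexity of the joint range, the point `(E, N²)` lies on a supporting line of slope `l ≥ 0`.
The intercept `μ` is nonnegative because there are unit vectors of arbitrarily small energy. -/
theorem exists_lagrange_multiplier {V F : Type*} [NormedAddCommGroup V]
    [InnerProductSpace ℂ V] [NormedAddCommGroup F] [InnerProductSpace ℂ F]
    (A S : V →ₗ[ℂ] F) {E N : ℝ} (hE : 0 < E)
    (hlow : ∀ δ > 0, ∃ u, ‖u‖ = 1 ∧ ‖S u‖ ^ 2 < δ)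
    (hN : ∀ u, ‖u‖ = 1 → ‖S u‖ ^ 2 ≤ E → ‖A u‖ ^ 2 ≤ N ^ 2) :
    ∃ μ l : ℝ, 0 ≤ μ ∧ 0 ≤ l ∧ μ + l * E = N ^ 2 ∧
      ∀ x, ‖A x‖ ^ 2 ≤ μ * ‖x‖ ^ 2 + l * ‖S x‖ ^ 2 := by
  have hslope : ∀ u v, ‖u‖ = 1 → ‖v‖ = 1 → ‖S u‖ ^ 2 < E → E < ‖S v‖ ^ 2 →
      (‖A v‖ ^ 2 - N ^ 2) / (‖S v‖ ^ 2 - E) ≤ (N ^ 2 - ‖A u‖ ^ 2) / (E - ‖S u‖ ^ 2) := by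
    intro u v hu hv h1 h2
    have hd : 0 < ‖S v‖ ^ 2 - ‖S u‖ ^ 2 := by linarith
    obtain ⟨w, hw, hwS, hwA⟩ := exists_unit_convexCombination A S hu hv (by linarith)
      (t := (E - ‖S u‖ ^ 2) / (‖S v‖ ^ 2 - ‖S u‖ ^ 2))
      ⟨div_nonneg (by linarith) hd.le, (div_le_one hd).mpr (by linarith)⟩
    have htd := div_mul_cancel₀ (E - ‖S u‖ ^ 2) hd.ne'
    set t := (E - ‖S u‖ ^ 2) / (‖S v‖ ^ 2 - ‖S u‖ ^ 2)
    have h3 := hN w hw (by rw [hwS]; linarith)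
    rw [hwA] at h3
    rw [div_le_div_iff₀ (by linarith) (by linarith)]
    have h4 : E - ‖S u‖ ^ 2 = t * (‖S v‖ ^ 2 - ‖S u‖ ^ 2) := htd.symm
    have h5 : ‖S v‖ ^ 2 - E = (1 - t) * (‖S v‖ ^ 2 - ‖S u‖ ^ 2) := by linarith
    rw [h4, h5]
    nlinarith
  set B : Set ℝ := {r | r = 0 ∨ ∃ v, ‖v‖ = 1 ∧ E < ‖S v‖ ^ 2 ∧
    r = (‖A v‖ ^ 2 - N ^ 2) / (‖S v‖ ^ 2 - E)} with hB
  have hub : ∀ u, ‖u‖ = 1 → ‖S u‖ ^ 2 < E →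
      (N ^ 2 - ‖A u‖ ^ 2) / (E - ‖S u‖ ^ 2) ∈ upperBounds B := by
    rintro u hu hSu r (rfl | ⟨v, hv, hSv, rfl⟩)
    · exact div_nonneg (by linarith [hN u hu hSu.le]) (by linarith)
    · exact hslope u v hu hv hSu hSv
  have hbdd : BddAbove B := by
    obtain ⟨u, hu, hSu⟩ := hlow E hE
    exact ⟨_, hub u hu hSu⟩
  set l := sSup B with hl
  have hl0 : 0 ≤ l := le_csSup hbdd (Or.inl rfl)
  have hunit : ∀ u, ‖u‖ = 1 → ‖A u‖ ^ 2 ≤ N ^ 2 + l * (‖S u‖ ^ 2 - E) := by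
    intro u hu
    rcases lt_trichotomy (‖S u‖ ^ 2) E with h | h | h
    · have h1 : l ≤ (N ^ 2 - ‖A u‖ ^ 2) / (E - ‖S u‖ ^ 2) := csSup_le ⟨0, Or.inl rfl⟩ (hub u hu h)
      rw [le_div_iff₀ (by linarith)] at h1
      linarith
    · rw [h, sub_self, mul_zero, add_zero]; exact hN u hu h.le
    · have h1 : (‖A u‖ ^ 2 - N ^ 2) / (‖S u‖ ^ 2 - E) ≤ l :=
        le_csSup hbdd (Or.inr ⟨u, hu, h, rfl⟩)
      rw [div_le_iff₀ (by linarith)] at h1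
      linarith
  refine ⟨N ^ 2 - l * E, l, ?_, hl0, by ring, fun x => ?_⟩
  · by_contra! hneg
    obtain ⟨u, hu, hSu⟩ := hlow ((l * E - N ^ 2) / (l + 1)) (div_pos (by linarith) (by linarith))
    rw [lt_div_iff₀ (by linarith)] at hSu
    nlinarith [hunit u hu, sq_nonneg ‖A u‖, sq_nonneg ‖S u‖]
  · by_cases hx : x = 0
    · simp [hx]
    · have hx0 : ‖x‖ ≠ 0 := norm_ne_zero_iff.mpr hx
      have h := hunit (((‖x‖⁻¹ : ℝ) : ℂ) • x) (by
        rw [norm_smul, Complex.norm_real, norm_inv, norm_norm, inv_mul_cancel₀ hx0])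
      rw [map_smul, map_smul, norm_smul, norm_smul, Complex.norm_real, norm_inv, norm_norm,
        mul_pow, mul_pow, inv_pow] at h
      have hx2 : 0 < ‖x‖ ^ 2 := by positivity
      have e1 : ‖A x‖ ^ 2 = ‖x‖ ^ 2 * ((‖x‖ ^ 2)⁻¹ * ‖A x‖ ^ 2) := by field_simp
      have e2 : ‖S x‖ ^ 2 = ‖x‖ ^ 2 * ((‖x‖ ^ 2)⁻¹ * ‖S x‖ ^ 2) := by field_simp
      rw [e1, e2]
      nlinarith [mul_le_mul_of_nonneg_left h hx2.le]

variable {H : Type*} [NormedAddCommGroup H] [InnerProductSpace ℂ H] [CompleteSpace H]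

/-! ### Vectors of low and of high energy -/

theorem exists_unit_graph_lt {G : H →ₗ.[ℂ] H} (hG : IsPosSelfAdjoint G)
    (hinf : IsGLB {r : ℝ | ∃ φ : G.domain, ‖(φ : H)‖ = 1 ∧ r = ‖G φ‖} 0) {δ : ℝ} (hδ : 0 < δ) :
    ∃ u w : H, (u, w) ∈ (posSqrt G).graph ∧ ‖u‖ = 1 ∧ ‖w‖ ^ 2 < δ := by
  obtain ⟨r, ⟨φ, hφ, rfl⟩, -, hr⟩ := hinf.exists_between hδ
  have hS := posSqrt_spec hG
  obtain ⟨z, h1, h2⟩ := (hS.2 _ _).mp (G.mem_graph φ)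
  refine ⟨φ, z, h1, hφ, lt_of_le_of_lt ?_ hr⟩
  rw [← re_inner_self, symm_graph hS.1 h1 h2]
  exact (re_inner_le_norm (𝕜 := ℂ) _ _).trans_eq (by rw [hφ, one_mul])

theorem exists_unit_graph_gt {G : H →ₗ.[ℂ] H} (hG : IsPosSelfAdjoint G) (hunb : IsUnbounded G)
    (M : ℝ) : ∃ u w : H, (u, w) ∈ (posSqrt G).graph ∧ ‖u‖ = 1 ∧ M < ‖w‖ ^ 2 := by
  by_contra! hM
  set C := max M 0 with hC
  have hC0 : 0 ≤ C := le_max_right _ _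
  have hle : ∀ a b : H, (a, b) ∈ (posSqrt G).graph → ‖b‖ ^ 2 ≤ C * ‖a‖ ^ 2 := by
    intro a b hab
    by_cases ha : a = 0
    · have := (posSqrt G).graph_fst_eq_zero_snd hab ha
      simp [ha, this]
    · have ha0 : ‖a‖ ≠ 0 := norm_ne_zero_iff.mpr ha
      have h := (posSqrt G).graph.smul_mem ((‖a‖⁻¹ : ℝ) : ℂ) hab
      rw [Prod.smul_mk] at h
      have h1 := hM _ _ h (by
        rw [norm_smul, Complex.norm_real, norm_inv, norm_norm, inv_mul_cancel₀ ha0])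
      rw [norm_smul, Complex.norm_real, norm_inv, norm_norm, mul_pow, inv_pow,
        inv_mul_le_iff₀ (by positivity)] at h1
      have h2 : ‖a‖ ^ 2 * M ≤ ‖a‖ ^ 2 * C := by gcongr; exact le_max_left _ _
      linarith
  refine hunb ⟨C, fun x => ?_⟩
  obtain ⟨z, h1, h2⟩ := ((posSqrt_spec hG).2 _ _).mp (G.mem_graph x)
  refine abs_le_of_sq_le_sq' ?_ (by positivity) |>.2
  calc ‖G x‖ ^ 2 ≤ C * ‖z‖ ^ 2 := hle _ _ h2
    _ ≤ C * (C * ‖(x : H)‖ ^ 2) := by gcongr; exact hle _ _ h1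
    _ = (C * ‖(x : H)‖) ^ 2 := by ring

theorem energy_le_iff {G : H →ₗ.[ℂ] H} {E : ℝ} (hE : 0 ≤ E) {φ : H} :
    energy G φ ≤ ENNReal.ofReal E ↔ ∃ w, (φ, w) ∈ (posSqrt G).graph ∧ ‖w‖ ^ 2 ≤ E := by
  constructor
  · intro h
    obtain ⟨w, hw⟩ := exists_graph_of_energy_ne_top (ne_top_of_le_ne_top ENNReal.ofReal_ne_top h)
    rw [energy_of_mem_graph hw] at h
    exact ⟨w, hw, (ENNReal.ofReal_le_ofReal_iff hE).mp h⟩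
  · rintro ⟨w, hw, h⟩
    rw [energy_of_mem_graph hw]
    exact ENNReal.ofReal_le_ofReal h

/-! ### The operator E-norm as a constrained maximum -/

theorem isLUB_eNorm {G : H →ₗ.[ℂ] H} (hG : IsPosSelfAdjoint G)
    (hinf : IsGLB {r : ℝ | ∃ φ : G.domain, ‖(φ : H)‖ = 1 ∧ r = ‖G φ‖} 0)
    (A : H →L[ℂ] H) {E : ℝ} (hE : 0 < E) :
    IsLUB {r : ℝ | ∃ φ : H, ‖φ‖ = 1 ∧ energy G φ ≤ ENNReal.ofReal E ∧ r = ‖A φ‖}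
      (eNorm G E A) := by
  refine isLUB_csSup ?_ ⟨‖A‖, ?_⟩
  · obtain ⟨u, w, huw, hu, hw⟩ := exists_unit_graph_lt hG hinf hE
    exact ⟨_, u, hu, (energy_le_iff hE.le).mpr ⟨w, huw, hw.le⟩, rfl⟩
  · rintro _ ⟨φ, hφ, -, rfl⟩
    exact (A.le_opNorm φ).trans_eq (by rw [hφ, mul_one])

theorem eNorm_nonneg (G : H →ₗ.[ℂ] H) (E : ℝ) (A : H →L[ℂ] H) : 0 ≤ eNorm G E A := by
  refine Real.sSup_nonneg ?_
  rintro _ ⟨φ, -, -, rfl⟩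
  exact norm_nonneg _

theorem eNorm_lagrange {G : H →ₗ.[ℂ] H} (hG : IsPosSelfAdjoint G)
    (hinf : IsGLB {r : ℝ | ∃ φ : G.domain, ‖(φ : H)‖ = 1 ∧ r = ‖G φ‖} 0)
    (A : H →L[ℂ] H) {E : ℝ} (hE : 0 < E) :
    ∃ μ l : ℝ, 0 ≤ μ ∧ 0 ≤ l ∧ μ + l * E = eNorm G E A ^ 2 ∧
      ∀ x z, (x, z) ∈ (posSqrt G).graph → ‖A x‖ ^ 2 ≤ μ * ‖x‖ ^ 2 + l * ‖z‖ ^ 2 := by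
  obtain ⟨μ, l, hμ, hl, h1, h2⟩ := exists_lagrange_multiplier
    (A.toLinearMap ∘ₗ (posSqrt G).domain.subtype) (posSqrt G).toFun (N := eNorm G E A) hE
    (fun δ hδ => by
      obtain ⟨u, w, huw, hu, hw⟩ := exists_unit_graph_lt hG hinf hδ
      obtain ⟨x, rfl, rfl⟩ := (LinearPMap.mem_graph_iff _).mp huw
      exact ⟨x, hu, hw⟩)
    (fun u hu hSu => pow_le_pow_left₀ (norm_nonneg _) ((isLUB_eNorm hG hinf A hE).1
      ⟨u, hu, (energy_le_iff hE.le).mpr ⟨_, (posSqrt G).mem_graph u, hSu⟩, rfl⟩) 2)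
  refine ⟨μ, l, hμ, hl, h1, fun x z hxz => ?_⟩
  obtain ⟨x, rfl, rfl⟩ := (LinearPMap.mem_graph_iff _).mp hxz
  exact h2 x

theorem isLUB_of_subset_of_mem_upperBounds {s t : Set ℝ} {b : ℝ} (hs : IsLUB s b) (hst : s ⊆ t)
    (hb : b ∈ upperBounds t) : IsLUB t b :=
  ⟨hb, fun _ hc => hs.2 fun _ hx => hc (hst hx)⟩

theorem norm_le_eNorm {G : H →ₗ.[ℂ] H} (hG : IsPosSelfAdjoint G)
    (hinf : IsGLB {r : ℝ | ∃ φ : G.domain, ‖(φ : H)‖ = 1 ∧ r = ‖G φ‖} 0)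
    (A : H →L[ℂ] H) {E : ℝ} (hE : 0 < E) {φ : H} (hφ : ‖φ‖ ≤ 1)
    (hφE : energy G φ ≤ ENNReal.ofReal E) : ‖A φ‖ ≤ eNorm G E A := by
  obtain ⟨μ, l, hμ, hl, h1, h2⟩ := eNorm_lagrange hG hinf A hE
  obtain ⟨w, hw, hwE⟩ := (energy_le_iff hE.le).mp hφE
  refine (abs_le_of_sq_le_sq' ?_ (eNorm_nonneg G E A)).2
  have h3 : ‖φ‖ ^ 2 ≤ 1 := pow_le_one₀ (norm_nonneg _) hφ
  calc ‖A φ‖ ^ 2 ≤ μ * ‖φ‖ ^ 2 + l * ‖w‖ ^ 2 := h2 _ _ hw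
    _ ≤ μ * 1 + l * E := by gcongr
    _ = eNorm G E A ^ 2 := by rw [mul_one, h1]

theorem sqrtTrace_le_eNorm {G : H →ₗ.[ℂ] H} (hG : IsPosSelfAdjoint G)
    (hinf : IsGLB {r : ℝ | ∃ φ : G.domain, ‖(φ : H)‖ = 1 ∧ r = ‖G φ‖} 0)
    (A : H →L[ℂ] H) {E : ℝ} (hE : 0 < E) {ρ : H →L[ℂ] H} (hρ : ρ ∈ subnormalized H)
    (hρE : meanEnergy G ρ ≤ ENNReal.ofReal E) : sqrtTrace A ρ ≤ eNorm G E A := by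
  obtain ⟨μ, l, hμ, hl, h1, h2⟩ := eNorm_lagrange hG hinf A hE
  refine Real.sqrt_le_iff.mpr ⟨eNorm_nonneg G E A, ?_⟩
  rw [← h1]
  exact trace_conj_le_of_forall hG hμ hl hE.le h2 hρ hρE

theorem states_subset_subnormalized : states H ⊆ subnormalized H :=
  fun ρ hρ => ⟨hρ.1, by rw [hρ.2]; simp⟩

/-- For unbounded `G` a unit vector of energy at most `E` is moved to energy exactly `E` by a small
admixture of a vector of very high energy. -/
theorem isLUB_eNorm_energy_eq {G : H →ₗ.[ℂ] H} (hG : IsPosSelfAdjoint G)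
    (hinf : IsGLB {r : ℝ | ∃ φ : G.domain, ‖(φ : H)‖ = 1 ∧ r = ‖G φ‖} 0)
    (hunb : IsUnbounded G) (A : H →L[ℂ] H) {E : ℝ} (hE : 0 < E) :
    IsLUB {r : ℝ | ∃ φ : H, ‖φ‖ = 1 ∧ energy G φ = ENNReal.ofReal E ∧ r = ‖A φ‖}
      (eNorm G E A) := by
  constructor
  · rintro _ ⟨φ, hφ, hφE, rfl⟩
    exact norm_le_eNorm hG hinf A hE hφ.le hφE.le
  · intro b hb
    refine (isLUB_eNorm hG hinf A hE).2 ?_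
    rintro _ ⟨φ, hφ, hφE, rfl⟩
    obtain ⟨w, hw, hwE⟩ := (energy_le_iff hE.le).mp hφE
    by_contra! hlt
    -- the weight `t` of the admixture is below `(E - ‖w‖²) / (M - ‖w‖²)`, hence the choice of `M`;
    -- `0 ≤ b` is known only once some unit vector of energy `E` has been found
    have hM : ∃ M, E ≤ M ∧ ∀ q, M < q → ∀ t, 0 ≤ t → t * (q - ‖w‖ ^ 2) = E - ‖w‖ ^ 2 →
        0 ≤ b → b ^ 2 < (1 - t) * ‖A φ‖ ^ 2 := by
      by_cases hb0 : 0 ≤ b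
      · have hδ : 0 < ‖A φ‖ ^ 2 - b ^ 2 := by nlinarith
        set δ := ‖A φ‖ ^ 2 - b ^ 2 with hδ'
        have hX : 0 ≤ (E - ‖w‖ ^ 2) * ‖A φ‖ ^ 2 / δ :=
          div_nonneg (mul_nonneg (by linarith) (sq_nonneg _)) hδ.le
        refine ⟨E + (E - ‖w‖ ^ 2) * ‖A φ‖ ^ 2 / δ, by linarith, fun q hq t ht0 ht _ => ?_⟩
        have hq0 : 0 < q - ‖w‖ ^ 2 := by linarith
        have h1 : (E - ‖w‖ ^ 2) * ‖A φ‖ ^ 2 < δ * (q - ‖w‖ ^ 2) := by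
          rw [← div_lt_iff₀' hδ]; linarith
        have h2 : t * ‖A φ‖ ^ 2 < δ := by
          refine lt_of_mul_lt_mul_right ?_ hq0.le
          calc t * ‖A φ‖ ^ 2 * (q - ‖w‖ ^ 2) = (E - ‖w‖ ^ 2) * ‖A φ‖ ^ 2 := by rw [← ht]; ring
            _ < δ * (q - ‖w‖ ^ 2) := h1
        linarith
      · exact ⟨E, le_rfl, fun _ _ _ _ _ h => absurd h hb0⟩
    obtain ⟨M, hEM, hM⟩ := hM
    obtain ⟨v, y, hvy, hv, hy⟩ := exists_unit_graph_gt hG hunb M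
    obtain ⟨φ, rfl, rfl⟩ := (LinearPMap.mem_graph_iff _).mp hw
    obtain ⟨v, rfl, rfl⟩ := (LinearPMap.mem_graph_iff _).mp hvy
    set q₀ := ‖posSqrt G φ‖ ^ 2 with hq₀
    set q := ‖posSqrt G v‖ ^ 2 with hq
    have hd : 0 < q - q₀ := by linarith
    have ht0 : 0 ≤ (E - q₀) / (q - q₀) := div_nonneg (by linarith) hd.le
    have htd := div_mul_cancel₀ (E - q₀) hd.ne'
    obtain ⟨x, hx, hxS, hxA⟩ := exists_unit_convexCombination
      (A.toLinearMap ∘ₗ (posSqrt G).domain.subtype) (posSqrt G).toFun (u := φ) (v := v) hφ hv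
      (by change q₀ ≠ q; linarith) (t := (E - q₀) / (q - q₀))
      ⟨ht0, (div_le_one hd).mpr (by linarith)⟩
    set t := (E - q₀) / (q - q₀)
    change ‖posSqrt G x‖ ^ 2 = (1 - t) * q₀ + t * q at hxS
    change ‖A x‖ ^ 2 = (1 - t) * ‖A φ‖ ^ 2 + t * ‖A v‖ ^ 2 at hxA
    have hxE : energy G x = ENNReal.ofReal E := by
      rw [energy_of_mem_graph ((posSqrt G).mem_graph x), hxS]
      congr 1; linarith
    have hxb : ‖A x‖ ≤ b := hb ⟨x, hx, hxE, rfl⟩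
    have h1 := hM q hy t ht0 htd ((norm_nonneg _).trans hxb)
    have h2 : ‖A x‖ ^ 2 ≤ b ^ 2 := by gcongr
    have h3 : 0 ≤ t * ‖A v‖ ^ 2 := by positivity
    linarith

/-! ### Discrete operators: compactness of the energy-constrained unit sphere -/

/-- The spectral projectors of a discrete operator have finite rank: `Pₙ τₖ = 0` as soon as
`eₖ > n`, since `Pₙ τₖ` is an eigenvector for `eₖ` in a subspace on which `G ≤ n`. -/
theorem exists_finiteDimensional_of_isDiscrete {G : H →ₗ.[ℂ] H} (hG : IsPosSelfAdjoint G)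
    (hd : IsDiscrete G) {n : ℝ} (hn : 0 ≤ n) :
    ∃ F : Submodule ℂ H, FiniteDimensional ℂ F ∧ ∀ x, spectralProj G n x ∈ F := by
  obtain ⟨e, τ, -, he, hdom, hsum⟩ := hd
  have hP := spectralProj_spec hG hn
  have hτ : ∀ k j, k ≠ j → ⟪τ k, τ j⟫_ℂ = 0 := fun k j h => τ.orthonormal.2 h
  have hgraph : ∀ j, (τ j, (e j : ℂ) • τ j) ∈ G.graph := by
    intro j
    have hj : τ j ∈ G.domain := by
      rw [hdom]
      refine summable_of_ne_finset_zero (s := {j}) fun k hk => ?_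
      rw [hτ k j (by simpa using hk)]; simp
    have h1 : HasSum (fun k => ((e k : ℂ) * ⟪τ k, τ j⟫_ℂ) • τ k) ((e j : ℂ) • τ j) := by
      have h := hasSum_single (f := fun k => ((e k : ℂ) * ⟪τ k, τ j⟫_ℂ) • τ k) j fun k hk => by
        rw [hτ k j hk, mul_zero, zero_smul]
      rwa [inner_self_eq_norm_sq_to_K, τ.orthonormal.1 j, RCLike.ofReal_one, one_pow,
        mul_one] at h
    rw [← (hsum ⟨τ j, hj⟩).unique h1]
    exact G.mem_graph ⟨τ j, hj⟩
  have hker : ∀ k, n < e k → spectralProj G n (τ k) = 0 := by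
    intro k hk
    have hg := hP.commutes _ _ (hgraph k)
    rw [map_smul] at hg
    set y := spectralProj G n (τ k) with hy
    have hyd := LinearPMap.mem_domain_of_mem_graph hg
    have h1 := hP.le_on_range ⟨y, hyd⟩ (starProjection_apply_apply hP.isStarProjection _)
    rw [LinearPMap.mem_graph_snd_inj _ (G.mem_graph ⟨y, hyd⟩) hg rfl, inner_smul_right,
      Complex.re_ofReal_mul, re_inner_self] at h1
    have h2 : ‖y‖ ^ 2 ≤ 0 := by
      simp only at h1
      by_contra! h
      nlinarith
    simpa using h2
  obtain ⟨m, hm⟩ := (he.eventually_gt_atTop n).exists_forall_of_atTop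
  refine ⟨Submodule.span ℂ (τ '' (Finset.range m : Set ℕ)),
    FiniteDimensional.span_of_finite ℂ ((Finset.finite_toSet _).image _), fun x => ?_⟩
  have h1 := τ.hasSum_repr (spectralProj G n x)
  have h2 : HasSum (fun k => τ.repr (spectralProj G n x) k • τ k)
      (∑ k ∈ Finset.range m, τ.repr (spectralProj G n x) k • τ k) :=
    hasSum_sum_of_ne_finset_zero fun k hk => by
      rw [τ.repr_apply_apply, ← inner_starProjection_left hP.isStarProjection,
        hker k (hm k (by simpa using hk)), inner_zero_left, zero_smul]
  rw [h1.unique h2]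
  exact Submodule.sum_mem _ fun k hk => Submodule.smul_mem _ _
    (Submodule.subset_span ⟨k, hk, rfl⟩)

theorem isCompact_unit_energy_le {G : H →ₗ.[ℂ] H} (hG : IsPosSelfAdjoint G)
    (hd : IsDiscrete G) {E : ℝ} (hE : 0 < E) :
    IsCompact {φ : H | ‖φ‖ = 1 ∧ energy G φ ≤ ENNReal.ofReal E} := by
  refine TotallyBounded.isCompact_of_isClosed ?_ ?_
  · rw [Metric.totallyBounded_iff]
    intro ε hε
    obtain ⟨n, hn⟩ := exists_nat_gt (E / (ε / 2) ^ 2)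
    have hn0 : (0 : ℝ) < n := lt_of_le_of_lt (by positivity) hn
    have hP := (spectralProj_spec hG hn0.le).isStarProjection
    obtain ⟨F, hF, hFx⟩ := exists_finiteDimensional_of_isDiscrete hG hd hn0.le
    have : ProperSpace F := FiniteDimensional.proper ℂ F
    have hc := (isCompact_closedBall (0 : F) 1).image F.subtypeL.continuous
    obtain ⟨t, ht, hcov⟩ := Metric.totallyBounded_iff.mp hc.totallyBounded (ε / 2) (by positivity)
    refine ⟨t, ht, ?_⟩
    rintro φ ⟨hφ, hφE⟩
    obtain ⟨w, hw, hwE⟩ := (energy_le_iff hE.le).mp hφE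
    have hle : ‖spectralProj G n φ‖ ≤ 1 := (norm_starProjection_apply_le hP φ).trans hφ.le
    have hmem : spectralProj G n φ ∈ F.subtypeL '' Metric.closedBall (0 : F) 1 :=
      ⟨⟨_, hFx φ⟩, by simpa using hle, rfl⟩
    obtain ⟨y, hy, hφy⟩ := Set.mem_iUnion₂.mp (hcov hmem)
    refine Set.mem_iUnion₂.mpr ⟨y, hy, ?_⟩
    have h1 := (cutoff_mul_norm_sub_sq_le hG hn0.le hw).trans hwE
    rw [div_lt_iff₀ (by positivity)] at hn
    have h2 : ‖φ - spectralProj G n φ‖ < ε / 2 := by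
      refine lt_of_pow_lt_pow_left₀ 2 (by positivity) ?_
      exact lt_of_mul_lt_mul_left (h1.trans_lt hn) hn0.le
    rw [Metric.mem_ball] at hφy ⊢
    rw [← dist_eq_norm] at h2
    linarith [dist_triangle φ (spectralProj G n φ) y]
  · have : {φ : H | ‖φ‖ = 1 ∧ energy G φ ≤ ENNReal.ofReal E}
        = {φ | ‖φ‖ = 1} ∩ ⋂ n : ℕ, {φ | truncatedEnergy G n φ ≤ E} := by
      ext φ
      simp only [Set.mem_ofPred_eq, Set.mem_inter_iff, Set.mem_iInter]
      rw [← iSup_truncatedEnergy hG, iSup_le_iff]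
      simp only [ENNReal.ofReal_le_ofReal_iff hE.le]
    rw [this]
    exact (isClosed_eq continuous_norm continuous_const).inter (isClosed_iInter fun n =>
      isClosed_le (continuous_truncatedEnergy hG (Nat.cast_nonneg n)) continuous_const)

theorem exists_norm_eq_eNorm {G : H →ₗ.[ℂ] H} (hG : IsPosSelfAdjoint G)
    (hinf : IsGLB {r : ℝ | ∃ φ : G.domain, ‖(φ : H)‖ = 1 ∧ r = ‖G φ‖} 0)
    (hd : IsDiscrete G) (A : H →L[ℂ] H) {E : ℝ} (hE : 0 < E) :
    ∃ φ : H, ‖φ‖ = 1 ∧ energy G φ ≤ ENNReal.ofReal E ∧ ‖A φ‖ = eNorm G E A := by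
  have hlub := isLUB_eNorm hG hinf A hE
  obtain ⟨_, φ₁, h₁, h₁E, -⟩ := hlub.nonempty
  obtain ⟨φ, ⟨hφ, hφE⟩, hmax⟩ := (isCompact_unit_energy_le hG hd hE).exists_isMaxOn
    ⟨φ₁, h₁, h₁E⟩ (f := fun φ => ‖A φ‖) (by fun_prop)
  refine ⟨φ, hφ, hφE, le_antisymm (hlub.1 ⟨φ, hφ, hφE, rfl⟩) (hlub.2 ?_)⟩
  rintro _ ⟨ψ, hψ, hψE, rfl⟩
  exact hmax ⟨hψ, hψE⟩

/-- If a maximizer has energy below `E`, the energy constraint is not active: the Lagrange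
multiplier vanishes and `‖A‖` is the unconstrained maximum. -/
theorem energy_eq_of_norm_eq_eNorm {G : H →ₗ.[ℂ] H} (hG : IsPosSelfAdjoint G)
    (hinf : IsGLB {r : ℝ | ∃ φ : G.domain, ‖(φ : H)‖ = 1 ∧ r = ‖G φ‖} 0)
    {A : H →L[ℂ] H} {E : ℝ} (hE : 0 < E) (hA : eNorm G E A < ‖A‖) {φ : H} (hφ : ‖φ‖ = 1)
    (hφE : energy G φ ≤ ENNReal.ofReal E) (hφA : ‖A φ‖ = eNorm G E A) :
    energy G φ = ENNReal.ofReal E := by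
  obtain ⟨μ, l, hμ, hl, h1, h2⟩ := eNorm_lagrange hG hinf A hE
  obtain ⟨w, hw, hwE⟩ := (energy_le_iff hE.le).mp hφE
  rw [energy_of_mem_graph hw]
  congr 1
  refine le_antisymm hwE (not_lt.mp fun hlt => hA.not_ge ?_)
  have h3 := h2 _ _ hw
  rw [hφA, hφ, ← h1] at h3
  have hl0 : l = 0 := by nlinarith
  rw [hl0, zero_mul, add_zero] at h1
  refine A.opNorm_le_bound (eNorm_nonneg G E A) ?_
  refine (posSqrt_spec hG).1.isSelfAdjoint.dense_domain.induction (fun x hx => ?_)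
    (isClosed_le (by fun_prop) (by fun_prop))
  obtain ⟨z, hz⟩ := LinearPMap.mem_domain_iff.mp hx
  have h4 := h2 x z hz
  rw [hl0, zero_mul, add_zero, h1, ← mul_pow] at h4
  exact (abs_le_of_sq_le_sq' h4 (mul_nonneg (eNorm_nonneg G E A) (norm_nonneg x))).2

end OperatorENorm

theorem proposition3 {H : Type*} [NormedAddCommGroup H] [InnerProductSpace ℂ H] [CompleteSpace H]
    [TopologicalSpace.SeparableSpace H]
    (G : H →ₗ.[ℂ] H) (hG : OperatorENorm.IsPosSelfAdjoint G)
    (hinf : IsGLB {r : ℝ | ∃ φ : G.domain, ‖(φ : H)‖ = 1 ∧ r = ‖G φ‖} 0)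
    (A : H →L[ℂ] H) (E : ℝ) (hE : 0 < E) :
    -- (A) all four suprema are equal to the operator E-norm
    (IsLUB {r : ℝ | ∃ φ : H, ‖φ‖ = 1 ∧
          OperatorENorm.energy G φ ≤ ENNReal.ofReal E ∧ r = ‖A φ‖}
        (OperatorENorm.eNorm G E A) ∧
      IsLUB {r : ℝ | ∃ φ : H, ‖φ‖ ≤ 1 ∧
          OperatorENorm.energy G φ ≤ ENNReal.ofReal E ∧ r = ‖A φ‖}
        (OperatorENorm.eNorm G E A) ∧
      IsLUB {r : ℝ | ∃ ρ ∈ OperatorENorm.states H,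
          OperatorENorm.meanEnergy G ρ ≤ ENNReal.ofReal E ∧ r = OperatorENorm.sqrtTrace A ρ}
        (OperatorENorm.eNorm G E A) ∧
      IsLUB {r : ℝ | ∃ ρ ∈ OperatorENorm.subnormalized H,
          OperatorENorm.meanEnergy G ρ ≤ ENNReal.ofReal E ∧ r = OperatorENorm.sqrtTrace A ρ}
        (OperatorENorm.eNorm G E A)) ∧
    -- (B) for unbounded `G` the energy constraint may be replaced by an equality
    (OperatorENorm.IsUnbounded G →
      IsLUB {r : ℝ | ∃ φ : H, ‖φ‖ = 1 ∧
          OperatorENorm.energy G φ = ENNReal.ofReal E ∧ r = ‖A φ‖}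
        (OperatorENorm.eNorm G E A) ∧
      IsLUB {r : ℝ | ∃ ρ ∈ OperatorENorm.states H,
          OperatorENorm.meanEnergy G ρ = ENNReal.ofReal E ∧ r = OperatorENorm.sqrtTrace A ρ}
        (OperatorENorm.eNorm G E A)) ∧
    -- (C) for discrete unbounded `G` the suprema are attained
    (OperatorENorm.IsDiscrete G → OperatorENorm.IsUnbounded G →
      (∃ φ : H, ‖φ‖ = 1 ∧ OperatorENorm.energy G φ ≤ ENNReal.ofReal E ∧
        ‖A φ‖ = OperatorENorm.eNorm G E A) ∧
      (∃ ρ ∈ OperatorENorm.states H, OperatorENorm.meanEnergy G ρ ≤ ENNReal.ofReal E ∧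
        OperatorENorm.sqrtTrace A ρ = OperatorENorm.eNorm G E A) ∧
      (OperatorENorm.eNorm G E A < ‖A‖ →
        (∃ φ₀ : H, ‖φ₀‖ = 1 ∧ OperatorENorm.energy G φ₀ = ENNReal.ofReal E ∧
          ‖A φ₀‖ = OperatorENorm.eNorm G E A) ∧
        (∃ ρ₀ ∈ OperatorENorm.states H, OperatorENorm.meanEnergy G ρ₀ = ENNReal.ofReal E ∧
          OperatorENorm.sqrtTrace A ρ₀ = OperatorENorm.eNorm G E A))) := by
  have hlub := OperatorENorm.isLUB_eNorm hG hinf A hE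
  -- a unit vector and the corresponding pure state have the same energy and the same value
  have pure_mem : ∀ {φ : H}, ‖φ‖ = 1 →
      InnerProductSpace.rankOne ℂ φ φ ∈ OperatorENorm.states H ∧
      OperatorENorm.meanEnergy G (InnerProductSpace.rankOne ℂ φ φ) = OperatorENorm.energy G φ ∧
      OperatorENorm.sqrtTrace A (InnerProductSpace.rankOne ℂ φ φ) = ‖A φ‖ := fun hφ =>
    ⟨OperatorENorm.rankOne_mem_states hφ, OperatorENorm.meanEnergy_rankOne hG _,
      OperatorENorm.sqrtTrace_rankOne A _⟩
  refine ⟨⟨hlub, ?_, ?_, ?_⟩, fun hunb => ?_, fun hd _ => ?_⟩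
  · refine OperatorENorm.isLUB_of_subset_of_mem_upperBounds hlub ?_ ?_
    · rintro _ ⟨φ, hφ, hφE, rfl⟩
      exact ⟨φ, hφ.le, hφE, rfl⟩
    · rintro _ ⟨φ, hφ, hφE, rfl⟩
      exact OperatorENorm.norm_le_eNorm hG hinf A hE hφ hφE
  · refine OperatorENorm.isLUB_of_subset_of_mem_upperBounds hlub ?_ ?_
    · rintro _ ⟨φ, hφ, hφE, rfl⟩
      obtain ⟨h1, h2, h3⟩ := pure_mem hφ
      exact ⟨_, h1, h2.trans_le hφE, h3.symm⟩
    · rintro _ ⟨ρ, hρ, hρE, rfl⟩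
      exact OperatorENorm.sqrtTrace_le_eNorm hG hinf A hE
        (OperatorENorm.states_subset_subnormalized hρ) hρE
  · refine OperatorENorm.isLUB_of_subset_of_mem_upperBounds hlub ?_ ?_
    · rintro _ ⟨φ, hφ, hφE, rfl⟩
      obtain ⟨h1, h2, h3⟩ := pure_mem hφ
      exact ⟨_, OperatorENorm.states_subset_subnormalized h1, h2.trans_le hφE, h3.symm⟩
    · rintro _ ⟨ρ, hρ, hρE, rfl⟩
      exact OperatorENorm.sqrtTrace_le_eNorm hG hinf A hE hρ hρE
  · have hlub' := OperatorENorm.isLUB_eNorm_energy_eq hG hinf hunb A hE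
    refine ⟨hlub', OperatorENorm.isLUB_of_subset_of_mem_upperBounds hlub' ?_ ?_⟩
    · rintro _ ⟨φ, hφ, hφE, rfl⟩
      obtain ⟨h1, h2, h3⟩ := pure_mem hφ
      exact ⟨_, h1, h2.trans hφE, h3.symm⟩
    · rintro _ ⟨ρ, hρ, hρE, rfl⟩
      exact OperatorENorm.sqrtTrace_le_eNorm hG hinf A hE
        (OperatorENorm.states_subset_subnormalized hρ) hρE.le
  · obtain ⟨φ, hφ, hφE, hφA⟩ := OperatorENorm.exists_norm_eq_eNorm hG hinf hd A hE
    obtain ⟨h1, h2, h3⟩ := pure_mem hφ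
    refine ⟨⟨φ, hφ, hφE, hφA⟩, ⟨_, h1, h2.trans_le hφE, h3.trans hφA⟩, fun hA => ?_⟩
    have hEq := OperatorENorm.energy_eq_of_norm_eq_eNorm hG hinf hE hA hφ hφE hφA
    exact ⟨⟨φ, hφ, hEq, hφA⟩, ⟨_, h1, h2.trans hEq, h3.trans hφA⟩⟩
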